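/- **Proposition 4.4.** Let $u=u_{\rm cusp}:\mathbb R\to(0,1]$ be the cusped soliton, i.e. the unique function satisfying $$|x|=\int_{u(x)}^1\frac{d\xi}{\sqrt{-\log(1-\xi^2)}},\qquad u(x)\in(0,1],\quad x\in\mathbb R$$ (so $u(0)=1$). Let $$\mathcal L=-(1-u^2)\partial_x^2+\frac{1+u^2}{1-u^2}$$ be the Newton linearized operator at $u$, regarded as an unbounded operator in $L^2(\mathbb R)$ with domain $$\mathrm{Dom}(\mathcal L)=\Big\{v\in L^2(\mathbb R):\ (1-u^2)v''\in L^2(\mathbb R),\ \tfrac{1+u^2}{1-u^2}\,v\in L^2(\mathbb R)\Big\},$$ where $v''\in L^1_{\rm loc}(\mathbb R\setminus\{0\})$ is the weak second derivative on $\mathbb R\setminus\{0\}$. Then, in the complex space $L^2(\mathbb R)$, the spectrum of $\mathcal L$ is exactly $$\sigma(\mathcal L)=[1,\infty).$$ Hence $\mathcal L$ is invertible: it has a bounded inverse $\mathcal L^{-1}:L^2(\mathbb R)\to \mathrm{Dom}(\mathcal L)\subset L^2(\mathbb R)$, on complex-valued and on real-valued functions. Consequently the Newton iteration $u_{n+1}=u_n-\mathcal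 L^{-1}F(u_n)$ for $F(g)=-(1-g^2)g''+g=0$ is well defined: for every real-valued $g\in L^2(\mathbb R)$ that has a weak second derivative on $\mathbb R\setminus\{0\}$ with $F(g)\in L^2(\mathbb R)$, there is exactly one $h\in L^2(\mathbb R)$ such that $g-h\in\mathrm{Dom}(\mathcal L)$ and $\mathcal L(g-h)=F(g)$. -/

import Mathlib

open MeasureTheory Set
open scoped ContDiff ENNReal

noncomputable section

/-! ## The cusped soliton -/

/-- The integrand `1 / √(-log (1 - ξ²))` of the implicit equation of the cusped soliton. -/
def cuspIntegrand (ξ : ℝ) : ℝ := (Real.sqrt (-Real.log (1 - ξ ^ 2)))⁻¹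

/-- `u` is the cusped soliton centred at the origin: its values lie in `(0, 1]` and
`|x| = ∫_{u(x)}^1 dξ / √(-log (1 - ξ²))` for every real `x` (in particular `u(0) = 1`). -/
def IsCuspedSoliton (u : ℝ → ℝ) : Prop :=
  ∀ x : ℝ, u x ∈ Ioc (0 : ℝ) 1 ∧ |x| = ∫ ξ in (u x)..1, cuspIntegrand ξ

theorem cuspIntegrand_pos {ξ : ℝ} (h0 : 0 < ξ) (h1 : ξ < 1) : 0 < cuspIntegrand ξ := by
  have h2 : 0 < 1 - ξ ^ 2 := by nlinarith
  have h3 : 1 - ξ ^ 2 < 1 := by nlinarith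
  have := Real.log_neg h2 h3
  exact inv_pos.2 (Real.sqrt_pos.2 (by linarith))

theorem cuspIntegrand_one : cuspIntegrand 1 = 0 := by simp [cuspIntegrand]

theorem cuspIntegrand_antitoneOn : AntitoneOn cuspIntegrand (Ioc 0 1) := by
  intro a ha b hb hab
  rcases hb.2.lt_or_eq with hb1 | rfl
  · have hb0 : 0 < 1 - b ^ 2 := by nlinarith [hb.1]
    have hab2 : 1 - b ^ 2 ≤ 1 - a ^ 2 := by nlinarith [ha.1]
    have ha3 : 1 - a ^ 2 < 1 := by nlinarith [ha.1]
    have h4 := Real.log_neg (hb0.trans_le hab2) ha3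
    have h5 := Real.log_le_log hb0 hab2
    exact inv_anti₀ (Real.sqrt_pos.2 (by linarith)) (Real.sqrt_le_sqrt (by linarith))
  · rw [cuspIntegrand_one]
    exact inv_nonneg.2 (Real.sqrt_nonneg _)

theorem cuspIntegrand_intervalIntegrable {a b : ℝ} (ha : a ∈ Ioc (0 : ℝ) 1)
    (hb : b ∈ Ioc (0 : ℝ) 1) : IntervalIntegrable cuspIntegrand volume a b := by
  apply AntitoneOn.intervalIntegrable
  apply cuspIntegrand_antitoneOn.mono
  intro x hx
  exact ⟨(lt_min ha.1 hb.1).trans_le hx.1, hx.2.trans (max_le ha.2 hb.2)⟩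

theorem one_mem_Ioc_cusp : (1 : ℝ) ∈ Ioc (0 : ℝ) 1 := ⟨one_pos, le_rfl⟩

theorem cuspIntegral_strictAntiOn :
    StrictAntiOn (fun s : ℝ => ∫ ξ in s..1, cuspIntegrand ξ) (Ioc 0 1) := by
  intro a ha b hb hab
  have h := intervalIntegral.integral_add_adjacent_intervals
    (cuspIntegrand_intervalIntegrable ha hb)
    (cuspIntegrand_intervalIntegrable hb one_mem_Ioc_cusp)
  have hpos : 0 < ∫ ξ in a..b, cuspIntegrand ξ :=
    intervalIntegral.intervalIntegral_pos_of_pos_on (cuspIntegrand_intervalIntegrable ha hb)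
      (fun x hx => cuspIntegrand_pos (ha.1.trans hx.1) (hx.2.trans_le hb.2)) hab
  simp only
  linarith

theorem cuspIntegrand_ge {ξ : ℝ} (h0 : 0 < ξ) (h1 : ξ ≤ 1 / 2) : (1 / 2) * ξ⁻¹ ≤ cuspIntegrand ξ := by
  have h2 : 0 < 1 - ξ ^ 2 := by nlinarith
  have h3 : 1 - ξ ^ 2 < 1 := by nlinarith
  have hlog := Real.log_neg h2 h3
  have h4 := Real.one_sub_inv_le_log_of_pos h2
  have h5 : (1 - ξ ^ 2)⁻¹ ≤ 1 + 4 * ξ ^ 2 := by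
    rw [inv_le_iff_one_le_mul₀ h2]
    nlinarith [sq_nonneg ξ, mul_nonneg (sq_nonneg ξ) (by nlinarith : 0 ≤ 1 / 4 - ξ ^ 2)]
  have h6 : Real.sqrt (-Real.log (1 - ξ ^ 2)) ≤ 2 * ξ := by
    rw [Real.sqrt_le_left (by linarith)]
    nlinarith
  have h7 := inv_anti₀ (Real.sqrt_pos.2 (by linarith : 0 < -Real.log (1 - ξ ^ 2))) h6
  rw [mul_inv] at h7
  simpa [cuspIntegrand] using h7

theorem exists_cuspIntegral_ge (y : ℝ) (hy : 0 ≤ y) :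
    ∃ s ∈ Ioc (0 : ℝ) 1, y ≤ ∫ ξ in s..1, cuspIntegrand ξ := by
  have he1 : Real.exp (-(2 * y)) ≤ 1 := Real.exp_le_one_iff.2 (by linarith)
  have he0 := Real.exp_pos (-(2 * y))
  set s : ℝ := 1 / 2 * Real.exp (-(2 * y)) with hs
  have hs0 : 0 < s := by positivity
  have hs2 : s ≤ 1 / 2 := by linarith
  have hsm : s ∈ Ioc (0 : ℝ) 1 := ⟨hs0, by linarith⟩
  have h2m : (1 / 2 : ℝ) ∈ Ioc (0 : ℝ) 1 := by constructor <;> norm_num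
  refine ⟨s, hsm, ?_⟩
  have h := intervalIntegral.integral_add_adjacent_intervals
    (cuspIntegrand_intervalIntegrable hsm h2m)
    (cuspIntegrand_intervalIntegrable h2m one_mem_Ioc_cusp)
  have hnn : 0 ≤ ∫ ξ in (1 / 2 : ℝ)..1, cuspIntegrand ξ :=
    intervalIntegral.integral_nonneg (by norm_num)
      (fun x _ => inv_nonneg.2 (Real.sqrt_nonneg _))
  have hmono : ∫ ξ in s..(1 / 2), (1 / 2) * ξ⁻¹ ≤ ∫ ξ in s..(1 / 2), cuspIntegrand ξ := by
    apply intervalIntegral.integral_mono_on hs2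
    · apply IntervalIntegrable.const_mul
      apply intervalIntegral.intervalIntegrable_inv (fun x hx => ?_) continuousOn_id
      rw [uIcc_of_le hs2] at hx
      exact (hs0.trans_le hx.1).ne'
    · exact cuspIntegrand_intervalIntegrable hsm h2m
    · exact fun x hx => cuspIntegrand_ge (hs0.trans_le hx.1) hx.2
  rw [intervalIntegral.integral_const_mul, integral_inv_of_pos hs0 (by norm_num)] at hmono
  have hl : Real.log (1 / 2 / s) = 2 * y := by
    have : (1 / 2 : ℝ) / s = Real.exp (2 * y) := by
      rw [hs, Real.exp_neg]
      field_simp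
    rw [this, Real.log_exp]
  rw [hl] at hmono
  linarith

/-- The implicit equation determines exactly one function. -/
theorem existsUnique_isCuspedSoliton : ∃! u : ℝ → ℝ, IsCuspedSoliton u := by
  have hex : ∀ x : ℝ, ∃ s, s ∈ Ioc (0 : ℝ) 1 ∧ |x| = ∫ ξ in s..1, cuspIntegrand ξ := by
    intro x
    obtain ⟨a, ha, hxa⟩ := exists_cuspIntegral_ge |x| (abs_nonneg x)
    have hcont : ContinuousOn (fun s : ℝ => ∫ ξ in s..1, cuspIntegrand ξ) (uIcc a 1) := by
      have := intervalIntegral.continuousOn_primitive_interval_left (μ := volume)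
        (f := cuspIntegrand) (a := a) (b := 1)
        ((intervalIntegrable_iff' (by simp)).1
          (cuspIntegrand_intervalIntegrable ha one_mem_Ioc_cusp))
      exact this
    rw [uIcc_of_le ha.2] at hcont
    have hivt := intermediate_value_Icc' ha.2 hcont
    have hmem : |x| ∈ Icc (∫ ξ in (1 : ℝ)..1, cuspIntegrand ξ)
        (∫ ξ in a..1, cuspIntegrand ξ) := by
      rw [intervalIntegral.integral_same]
      exact ⟨abs_nonneg x, hxa⟩
    obtain ⟨s, hs, hsx⟩ := hivt hmem
    exact ⟨s, ⟨ha.1.trans_le hs.1, hs.2⟩, hsx.symm⟩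
  choose u hu using hex
  refine ⟨u, hu, fun v hv => funext fun x => ?_⟩
  exact cuspIntegral_strictAntiOn.injOn (hv x).1 (hu x).1 ((hv x).2.symm.trans (hu x).2)

/-- The cusped soliton `u_cusp`. -/
def uCusp : ℝ → ℝ := existsUnique_isCuspedSoliton.choose

theorem isCuspedSoliton_uCusp : IsCuspedSoliton uCusp :=
  existsUnique_isCuspedSoliton.choose_spec.1

/-! ## The Newton linearized operator on `L²(ℝ)`

The scalar field `𝕜` is `ℝ` or `ℂ`. Derivatives are taken in the sense of distributions on
`ℝ \ {0}`, the complement of the point where the leading coefficient `1 - u_cusp²` vanishes. -/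

/-- `w` is the weak second derivative of `v` on `ℝ \ {0}`: it is locally integrable there, and
`∫ φ'' v = ∫ φ w` for all real test functions `φ` with compact support in `ℝ \ {0}`. -/
def HasWeakSecondDerivOffZero {𝕜 : Type} [RCLike 𝕜] (v w : ℝ → 𝕜) : Prop :=
  LocallyIntegrableOn w {0}ᶜ ∧
    ∀ φ : ℝ → ℝ, ContDiff ℝ ∞ φ → HasCompactSupport φ → tsupport φ ⊆ {0}ᶜ →
      ∫ x, iteratedDeriv 2 φ x • v x = ∫ x, φ x • w x

theorem integrable_testFunction_smul {𝕜 : Type} [RCLike 𝕜] {w : ℝ → 𝕜}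
    (hw : LocallyIntegrableOn w {0}ᶜ) {φ : ℝ → ℝ} (hφ : Continuous φ)
    (hc : HasCompactSupport φ) (hs : tsupport φ ⊆ {0}ᶜ) : Integrable (fun x => φ x • w x) := by
  have hK : IntegrableOn w (tsupport φ) := hw.integrableOn_compact_subset hs hc
  have h1 : IntegrableOn (fun x => φ x • w x) (tsupport φ) :=
    hK.continuousOn_smul hφ.continuousOn hc
  refine (integrableOn_iff_integrable_of_support_subset ?_).1 h1
  exact (Function.support_smul_subset_left φ w).trans (subset_tsupport φ)

theorem integrable_deriv_testFunction_smul {𝕜 : Type} [RCLike 𝕜] (v : Lp 𝕜 2 (volume : Measure ℝ))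
    {φ : ℝ → ℝ} (hφ : ContDiff ℝ ∞ φ) (hc : HasCompactSupport φ) :
    Integrable (fun x => iteratedDeriv 2 φ x • v x) := by
  have hv : LocallyIntegrable (v : ℝ → 𝕜) := (Lp.memLp v).locallyIntegrable (by norm_num)
  refine hv.integrable_smul_left_of_hasCompactSupport (hφ.continuous_iteratedDeriv 2 ?_) ?_
  · exact WithTop.coe_le_coe.2 le_top
  · rw [iteratedDeriv_succ, iteratedDeriv_one]
    exact hc.deriv.deriv

theorem HasWeakSecondDerivOffZero.add {𝕜 : Type} [RCLike 𝕜]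
    {v v' : Lp 𝕜 2 (volume : Measure ℝ)} {w w' : ℝ → 𝕜}
    (h : HasWeakSecondDerivOffZero v w) (h' : HasWeakSecondDerivOffZero v' w') :
    HasWeakSecondDerivOffZero (v + v' : Lp 𝕜 2 (volume : Measure ℝ)) (w + w') := by
  refine ⟨h.1.add h'.1, fun φ hφ hc hs => ?_⟩
  have e1 : ∫ x, iteratedDeriv 2 φ x • (v + v' : Lp 𝕜 2 (volume : Measure ℝ)) x
      = ∫ x, (iteratedDeriv 2 φ x • v x + iteratedDeriv 2 φ x • v' x) := by
    apply integral_congr_ae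
    filter_upwards [Lp.coeFn_add v v'] with x hx
    rw [hx, Pi.add_apply, smul_add]
  have e2 : ∫ x, φ x • (w + w') x = ∫ x, (φ x • w x + φ x • w' x) := by
    simp only [Pi.add_apply, smul_add]
  rw [e1, e2, integral_add (integrable_deriv_testFunction_smul v hφ hc)
    (integrable_deriv_testFunction_smul v' hφ hc),
    integral_add (integrable_testFunction_smul h.1 hφ.continuous hc hs)
    (integrable_testFunction_smul h'.1 hφ.continuous hc hs), h.2 φ hφ hc hs, h'.2 φ hφ hc hs]

theorem HasWeakSecondDerivOffZero.smul {𝕜 : Type} [RCLike 𝕜]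
    {v : Lp 𝕜 2 (volume : Measure ℝ)} {w : ℝ → 𝕜} (c : 𝕜) (h : HasWeakSecondDerivOffZero v w) :
    HasWeakSecondDerivOffZero (c • v : Lp 𝕜 2 (volume : Measure ℝ)) (c • w) := by
  refine ⟨h.1.smul c, fun φ hφ hc hs => ?_⟩
  have e1 : ∫ x, iteratedDeriv 2 φ x • (c • v : Lp 𝕜 2 (volume : Measure ℝ)) x
      = ∫ x, c • (iteratedDeriv 2 φ x • v x) := by
    apply integral_congr_ae
    filter_upwards [Lp.coeFn_smul c v] with x hx
    rw [hx, Pi.smul_apply, smul_comm]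
  have e2 : ∫ x, φ x • (c • w) x = ∫ x, c • (φ x • w x) := by
    refine integral_congr_ae (Filter.Eventually.of_forall fun x => ?_)
    simp only [Pi.smul_apply]
    rw [smul_comm]
  rw [e1, e2, integral_smul, integral_smul, h.2 φ hφ hc hs]

theorem HasWeakSecondDerivOffZero.zero {𝕜 : Type} [RCLike 𝕜] :
    HasWeakSecondDerivOffZero (0 : Lp 𝕜 2 (volume : Measure ℝ)) (0 : ℝ → 𝕜) := by
  refine ⟨(locallyIntegrable_zero).locallyIntegrableOn _, fun φ _ _ _ => ?_⟩
  have e1 : ∫ x, iteratedDeriv 2 φ x • (0 : Lp 𝕜 2 (volume : Measure ℝ)) x = ∫ _x : ℝ, (0 : 𝕜) := by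
    apply integral_congr_ae
    filter_upwards [Lp.coeFn_zero 𝕜 2 (volume : Measure ℝ)] with x hx
    rw [hx, Pi.zero_apply, smul_zero]
  rw [e1]
  simp

/-- A weak second derivative of the zero function vanishes almost everywhere. -/
theorem HasWeakSecondDerivOffZero.ae_eq_zero {𝕜 : Type} [RCLike 𝕜] {w : ℝ → 𝕜}
    (h : HasWeakSecondDerivOffZero (0 : Lp 𝕜 2 (volume : Measure ℝ)) w) : w =ᵐ[volume] 0 := by
  have h0 := isOpen_compl_singleton.ae_eq_zero_of_integral_contDiff_smul_eq_zero h.1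
    (fun φ hφ hc hs => by
      rw [← h.2 φ hφ hc hs, HasWeakSecondDerivOffZero.zero.2 φ hφ hc hs]
      simp)
  have h1 : ∀ᵐ x : ℝ, x ∈ ({0}ᶜ : Set ℝ) := compl_mem_ae_iff.2 (by simp)
  filter_upwards [h0, h1] with x hx hx1 using hx hx1

/-- The graph of `L = -(1 - u²) ∂² + (1 + u²) / (1 - u²)` in `L²(ℝ)`: the pairs `(v, f)` such
that `(1 - u²) v''` and `(1 + u²) / (1 - u²) * v` belong to `L²(ℝ)` and
`f = -(1 - u²) v'' + (1 + u²) / (1 - u²) * v`. -/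
def newtonGraph (𝕜 : Type) [RCLike 𝕜] (u : ℝ → ℝ) :
    Submodule 𝕜 (Lp 𝕜 2 (volume : Measure ℝ) × Lp 𝕜 2 (volume : Measure ℝ)) where
  carrier := {p | ∃ w : ℝ → 𝕜, HasWeakSecondDerivOffZero p.1 w ∧
    MemLp (fun x => (1 - u x ^ 2) • w x) 2 volume ∧
    MemLp (fun x => ((1 + u x ^ 2) / (1 - u x ^ 2)) • p.1 x) 2 volume ∧
    p.2 =ᵐ[volume] fun x => -((1 - u x ^ 2) • w x) + ((1 + u x ^ 2) / (1 - u x ^ 2)) • p.1 x}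
  add_mem' := by
    rintro ⟨v, f⟩ ⟨v', f'⟩ ⟨w, hw, h1, h2, h3⟩ ⟨w', hw', h1', h2', h3'⟩
    refine ⟨w + w', hw.add hw', ?_, ?_, ?_⟩
    · refine (h1.add h1').ae_eq (Filter.Eventually.of_forall fun x => ?_)
      simp only [Pi.add_apply, smul_add]
    · refine (h2.add h2').ae_eq ?_
      filter_upwards [Lp.coeFn_add v v'] with x hx
      simp only [Prod.mk_add_mk, Pi.add_apply, hx, smul_add]
    · filter_upwards [Lp.coeFn_add v v', Lp.coeFn_add f f', h3, h3'] with x hx hx' h4 h4'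
      simp only [Prod.mk_add_mk] at h4 h4' ⊢
      rw [hx', hx, Pi.add_apply, Pi.add_apply, Pi.add_apply, h4, h4']
      simp only [smul_add, neg_add]
      abel
  zero_mem' := by
    refine ⟨0, HasWeakSecondDerivOffZero.zero, by simp, ?_, ?_⟩
    · refine (MemLp.zero (ε := 𝕜)).ae_eq ?_
      filter_upwards [Lp.coeFn_zero 𝕜 2 (volume : Measure ℝ)] with x hx
      simp only [Prod.fst_zero, hx, Pi.zero_apply, smul_zero]
    · filter_upwards [Lp.coeFn_zero 𝕜 2 (volume : Measure ℝ)] with x hx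
      simp only [Prod.fst_zero, Prod.snd_zero, hx, Pi.zero_apply, smul_zero, neg_zero, add_zero]
  smul_mem' := by
    rintro c ⟨v, f⟩ ⟨w, hw, h1, h2, h3⟩
    refine ⟨c • w, hw.smul c, ?_, ?_, ?_⟩
    · refine (h1.const_smul c).ae_eq (Filter.Eventually.of_forall fun x => ?_)
      simp only [Pi.smul_apply]
      rw [smul_comm]
    · refine (h2.const_smul c).ae_eq ?_
      filter_upwards [Lp.coeFn_smul c v] with x hx
      simp only [Prod.smul_mk, Pi.smul_apply, hx]
      rw [smul_comm]
    · filter_upwards [Lp.coeFn_smul c v, Lp.coeFn_smul c f, h3] with x hx hx' h4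
      simp only [Prod.smul_mk] at h4 ⊢
      rw [hx', hx, Pi.smul_apply, Pi.smul_apply, Pi.smul_apply, h4, smul_add, smul_neg,
        smul_comm c (1 - u x ^ 2), smul_comm c ((1 + u x ^ 2) / (1 - u x ^ 2))]

/-- The relation `newtonGraph` is single-valued. -/
theorem newtonGraph_functional (𝕜 : Type) [RCLike 𝕜] (u : ℝ → ℝ) :
    ∀ p ∈ newtonGraph 𝕜 u, p.1 = 0 → p.2 = 0 := by
  rintro ⟨v, f⟩ ⟨w, hw, -, -, h3⟩ hv
  simp only at hv hw h3 ⊢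
  subst hv
  apply Lp.ext
  filter_upwards [h3, hw.ae_eq_zero, Lp.coeFn_zero 𝕜 2 (volume : Measure ℝ)] with x hx h4 h5
  simp only [hx, h4, h5, Pi.zero_apply, smul_zero, neg_zero, add_zero]

/-- The operator `L = -(1 - u²) ∂² + (1 + u²) / (1 - u²)` in `L²(ℝ)`, with domain
`{v ∈ L² : (1 - u²) v'' ∈ L² and (1 + u²) / (1 - u²) * v ∈ L²}`. -/
def newtonOp (𝕜 : Type) [RCLike 𝕜] (u : ℝ → ℝ) :
    Lp 𝕜 2 (volume : Measure ℝ) →ₗ.[𝕜] Lp 𝕜 2 (volume : Measure ℝ) :=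
  (newtonGraph 𝕜 u).toLinearPMap

theorem newtonOp_graph (𝕜 : Type) [RCLike 𝕜] (u : ℝ → ℝ) :
    (newtonOp 𝕜 u).graph = newtonGraph 𝕜 u :=
  Submodule.toLinearPMap_graph_eq _ (newtonGraph_functional 𝕜 u)

/-! ## Inverse, resolvent set and spectrum of an unbounded operator -/

/-- `R` is a bounded, everywhere defined, two-sided inverse of the unbounded operator `A`. -/
def IsBoundedInverse {𝕜 E : Type} [RCLike 𝕜] [NormedAddCommGroup E] [NormedSpace 𝕜 E]
    (A : E →ₗ.[𝕜] E) (R : E →L[𝕜] E) : Prop :=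
  (∀ f : E, ∃ h : R f ∈ A.domain, A ⟨R f, h⟩ = f) ∧ ∀ v : A.domain, R (A v) = v

/-- The operator `A - z`, with the same domain as `A`. -/
def shiftOp {𝕜 E : Type} [RCLike 𝕜] [NormedAddCommGroup E] [NormedSpace 𝕜 E]
    (A : E →ₗ.[𝕜] E) (z : 𝕜) : E →ₗ.[𝕜] E :=
  ⟨A.domain, A.toFun - z • A.domain.subtype⟩

/-- The spectrum of an unbounded operator: the complement of the set of all `z` for which
`A - z` has a bounded everywhere defined inverse. -/
def opSpectrum {E : Type} [NormedAddCommGroup E] [NormedSpace ℂ E] (A : E →ₗ.[ℂ] E) : Set ℂ :=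
  {z | ∃ R : E →L[ℂ] E, IsBoundedInverse (shiftOp A z) R}ᶜ

/-! ## Newton iterations for `F(u) = -(1 - u²) u'' + u = 0` -/

/-- `r = F(g) = -(1 - g²) g'' + g` in `L²(ℝ)`. -/
def IsNewtonResidual (g r : Lp ℝ 2 (volume : Measure ℝ)) : Prop :=
  ∃ w : ℝ → ℝ, HasWeakSecondDerivOffZero g w ∧ r =ᵐ[volume] fun x => -((1 - g x ^ 2) * w x) + g x

/-- `h = g - L⁻¹ F(g)`, where `L` is the linearization at `u`: the difference `g - h` is in the
domain of `L`, and `L (g - h) = F(g)`. -/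
def IsNewtonStep (u : ℝ → ℝ) (g h : Lp ℝ 2 (volume : Measure ℝ)) : Prop :=
  ∃ r, IsNewtonResidual g r ∧ ∃ hd : g - h ∈ (newtonOp ℝ u).domain, newtonOp ℝ u ⟨g - h, hd⟩ = r

end

open Filter Topology ComplexConjugate

/-! ### Elementary properties of the cusped soliton -/

/-! Write a = 1 - u². Since 1 + u² = 2u² + a, the equation L v - z v = f divided by a reads -v'' + q
v = f/a, where a² q = 2u² + (1 - z) a is the bounded function `cuspSymbol`. The natural unknowns are
thus g = v/a and h = v'. Put ζ = 1 - z and κ = |ζ| + conj ζ. The factor κ turns both 1 and ζ into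
the right half plane exactly when ζ is not in (-∞, 0], that is, when z is not in [1, ∞). As 2u² + a
≥ 1, the form Re κ(∫|v'|² + ∫ q|v|²) is then coercive for ‖v'‖² + ‖v/a‖²
(`le_re_multiplier_mul_cuspSymbol`).

Surjectivity with a bounded solution operator is Lax–Milgram on the closed space of pairs (g, h)
with h = (a g)' off 0 (`exists_laxMilgram_solution`, `exists_resolvent`). The solution lies in
Dom(L) at once, since (1 + u²)v/a = (1 + u²)g and a v'' = a² q g - f are in L².

For injectivity, the domain only gives v/a ∈ L², with no control of v' and no condition linking the
two sides of 0. Weak solutions on a half line are classical, and the energy identity is localized by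
a cutoff in the coordinate s = x - √(-log a). This s runs over all of ℝ on (0, ∞) and has 0 ≤ s' ≤
2/a, so 0 and ∞ are both infinitely far away. A cutoff at scale M costs O(M⁻²)∫|v/a|², which tends
to 0 (`integral_cutoff_le`, `classical_solution_eq_zero`). No boundary condition at 0 is needed.

Conversely u → 0 at infinity, so L looks like -∂² + 1 there. Plane waves e^{ikx} under wide plateaus
far out are approximate eigenfunctions for 1 + k², which excludes a bounded inverse
(`exists_weyl_sequence`). The point z = 0 then gives the inverse of L over ℝ and ℂ, and the Newton
step follows. -/

theorem uCusp_mem (x : ℝ) : uCusp x ∈ Ioc (0 : ℝ) 1 := (isCuspedSoliton_uCusp x).1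

theorem integral_uCusp (x : ℝ) : ∫ ξ in (uCusp x)..1, cuspIntegrand ξ = |x| :=
  (isCuspedSoliton_uCusp x).2.symm

theorem uCusp_integral {s : ℝ} (hs : s ∈ Ioc (0 : ℝ) 1) :
    uCusp (∫ ξ in s..1, cuspIntegrand ξ) = s := by
  apply cuspIntegral_strictAntiOn.injOn (uCusp_mem _) hs
  simp only [integral_uCusp]
  apply abs_of_nonneg
  have := cuspIntegral_strictAntiOn.antitoneOn hs one_mem_Ioc_cusp hs.2
  simpa using this

theorem uCusp_neg (x : ℝ) : uCusp (-x) = uCusp x := by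
  apply cuspIntegral_strictAntiOn.injOn (uCusp_mem _) (uCusp_mem _)
  simp only [integral_uCusp, abs_neg]

theorem uCusp_le_iff {s x : ℝ} (hs : s ∈ Ioc (0 : ℝ) 1) :
    uCusp x ≤ s ↔ ∫ ξ in s..1, cuspIntegrand ξ ≤ |x| := by
  rw [← integral_uCusp x]
  exact (cuspIntegral_strictAntiOn.le_iff_ge hs (uCusp_mem x)).symm

theorem uCusp_le_of_abs_le {x y : ℝ} (h : |x| ≤ |y|) : uCusp y ≤ uCusp x := by
  rw [uCusp_le_iff (uCusp_mem x), integral_uCusp]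
  exact h

theorem uCusp_lt_one {x : ℝ} (hx : x ≠ 0) : uCusp x < 1 := by
  refine lt_of_le_of_ne (uCusp_mem x).2 fun h => hx ?_
  have := integral_uCusp x
  rw [h, intervalIntegral.integral_same] at this
  exact abs_eq_zero.1 this.symm

/-- The weight `1 - u²`. -/
noncomputable def cuspWeight (x : ℝ) : ℝ := 1 - uCusp x ^ 2

theorem cuspWeight_nonneg (x : ℝ) : 0 ≤ cuspWeight x := by
  have := uCusp_mem x
  unfold cuspWeight
  nlinarith [this.1, this.2]

theorem cuspWeight_le_one (x : ℝ) : cuspWeight x ≤ 1 := by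
  unfold cuspWeight
  nlinarith [sq_nonneg (uCusp x)]

theorem cuspWeight_pos {x : ℝ} (hx : x ≠ 0) : 0 < cuspWeight x := by
  have := uCusp_mem x
  have := uCusp_lt_one hx
  unfold cuspWeight
  nlinarith [(uCusp_mem x).1]

theorem cuspWeight_neg (x : ℝ) : cuspWeight (-x) = cuspWeight x := by
  rw [cuspWeight, cuspWeight, uCusp_neg]

/-- On [0, ∞) the soliton is antitone; freezing it at its value at 0 for negative arguments gives a
globally antitone function, composed with |x|. -/
theorem measurable_uCusp : Measurable uCusp := by
  have h : Antitone fun t : ℝ => uCusp (max t 0) := by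
    intro s t hst
    apply uCusp_le_of_abs_le
    rw [abs_of_nonneg (le_max_right s 0), abs_of_nonneg (le_max_right t 0)]
    exact max_le_max_right 0 hst
  have h2 := h.measurable.comp (measurable_norm (α := ℝ))
  convert h2 using 1
  funext x
  simp only [Function.comp_apply, Real.norm_eq_abs, max_eq_left (abs_nonneg x)]
  exact le_antisymm (uCusp_le_of_abs_le (by simp)) (uCusp_le_of_abs_le (by simp))

theorem measurable_cuspWeight : Measurable cuspWeight :=
  measurable_const.sub (measurable_uCusp.pow_const 2)

/-- A monotone function has no jump at a point whose value is interior to its image, and the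
implicit equation makes u take every value in (0, 1) on (0, ∞). -/
theorem continuousAt_uCusp_of_pos {x : ℝ} (hx : 0 < x) : ContinuousAt uCusp x := by
  have hm : MonotoneOn (fun t => -uCusp t) (Ioi 0) := by
    intro s hs t ht hst
    refine neg_le_neg (uCusp_le_of_abs_le ?_)
    rwa [abs_of_pos hs, abs_of_pos ht]
  have himg : (fun t => -uCusp t) '' Ioi 0 ∈ 𝓝 (-uCusp x) := by
    refine mem_of_superset (Ioo_mem_nhds (a := -1) (b := 0) ?_ ?_) ?_
    · linarith [uCusp_lt_one hx.ne']
    · linarith [(uCusp_mem x).1]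
    · intro s hs
      have hs' : -s ∈ Ioc (0 : ℝ) 1 := ⟨by linarith [hs.2], by linarith [hs.1]⟩
      refine ⟨∫ ξ in (-s)..1, cuspIntegrand ξ, ?_, ?_⟩
      · have := cuspIntegral_strictAntiOn hs' one_mem_Ioc_cusp (by linarith [hs.1])
        simpa using this
      · simp only [uCusp_integral hs', neg_neg]
  have := continuousAt_of_monotoneOn_of_image_mem_nhds hm (Ioi_mem_nhds hx) himg
  exact (continuousAt_neg_iff (f := uCusp)).1 this

/-- The quantity `√(-log (1 - u²))`, which equals `|u'|` away from the origin. -/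
noncomputable def cuspSlope (x : ℝ) : ℝ := Real.sqrt (-Real.log (cuspWeight x))

theorem cuspWeight_lt_one (x : ℝ) : cuspWeight x < 1 := by
  have := (uCusp_mem x).1
  unfold cuspWeight
  nlinarith

theorem neg_log_cuspWeight_pos {x : ℝ} (hx : x ≠ 0) : 0 < -Real.log (cuspWeight x) := by
  have := Real.log_neg (cuspWeight_pos hx) (cuspWeight_lt_one x)
  linarith

theorem cuspSlope_pos {x : ℝ} (hx : x ≠ 0) : 0 < cuspSlope x :=
  Real.sqrt_pos.2 (neg_log_cuspWeight_pos hx)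

theorem continuousAt_cuspIntegrand {ξ : ℝ} (h0 : 0 < ξ) (h1 : ξ < 1) :
    ContinuousAt cuspIntegrand ξ := by
  have h2 : 0 < 1 - ξ ^ 2 := by nlinarith
  have h3 : 1 - ξ ^ 2 < 1 := by nlinarith
  have := Real.log_neg h2 h3
  unfold cuspIntegrand
  apply ContinuousAt.inv₀
  · apply Real.continuous_sqrt.continuousAt.comp
    exact ((continuousAt_const.sub (continuousAt_id.pow 2)).log h2.ne').neg
  · exact (Real.sqrt_pos.2 (by linarith)).ne'

theorem hasDerivAt_uCusp {x : ℝ} (hx : 0 < x) : HasDerivAt uCusp (-cuspSlope x) x := by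
  have h0 := (uCusp_mem x).1
  have h1 := uCusp_lt_one hx.ne'
  have hF : HasDerivAt (fun s => ∫ ξ in s..1, cuspIntegrand ξ) (-cuspIntegrand (uCusp x))
      (uCusp x) := by
    apply intervalIntegral.integral_hasDerivAt_left
      (cuspIntegrand_intervalIntegrable (uCusp_mem x) one_mem_Ioc_cusp) _
      (continuousAt_cuspIntegrand h0 h1)
    apply ContinuousAt.stronglyMeasurableAtFilter (s := Ioo 0 1) isOpen_Ioo
    · exact fun y hy => continuousAt_cuspIntegrand hy.1 hy.2
    · exact ⟨h0, h1⟩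
  have hne : -cuspIntegrand (uCusp x) ≠ 0 := neg_ne_zero.2 (cuspIntegrand_pos h0 h1).ne'
  have hinv : ∀ᶠ y in 𝓝 x, (∫ ξ in (uCusp y)..1, cuspIntegrand ξ) = y := by
    filter_upwards [Ioi_mem_nhds hx] with y hy
    rw [integral_uCusp, abs_of_pos hy]
  refine (HasDerivAt.of_local_left_inverse (continuousAt_uCusp_of_pos hx) hF hne hinv).congr_deriv ?_
  rw [inv_neg, cuspIntegrand, inv_inv]
  rfl

theorem hasDerivAt_cuspWeight {x : ℝ} (hx : 0 < x) :
    HasDerivAt cuspWeight (2 * uCusp x * cuspSlope x) x := by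
  refine HasDerivAt.congr_deriv (f := cuspWeight) (((hasDerivAt_uCusp hx).pow 2).const_sub 1) ?_
  simp

/-- As u' = -√(-log a) for x > 0, this is the soliton equation a u'' = u. The slope itself cancels,
which is what makes `cuspCoord` have a derivative comparable to 1/a at worst. -/
theorem hasDerivAt_cuspSlope {x : ℝ} (hx : 0 < x) :
    HasDerivAt cuspSlope (-(uCusp x / cuspWeight x)) x := by
  have ha := cuspWeight_pos hx.ne'
  have hp := cuspSlope_pos hx.ne'
  refine HasDerivAt.congr_deriv (f := cuspSlope)
    (((hasDerivAt_cuspWeight hx).log ha.ne').neg.sqrt (neg_log_cuspWeight_pos hx.ne').ne') ?_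
  change _ / (2 * cuspSlope x) = _
  field_simp

theorem continuousAt_cuspWeight {x : ℝ} (hx : x ≠ 0) : ContinuousAt cuspWeight x := by
  rcases hx.lt_or_gt with h | h
  · have h1 : ContinuousAt cuspWeight (-x) := (hasDerivAt_cuspWeight (neg_pos.2 h)).continuousAt
    have h2 := ContinuousAt.comp (f := fun y : ℝ => -y) (g := cuspWeight) h1 continuousAt_neg
    refine h2.congr (Eventually.of_forall fun y => ?_)
    exact cuspWeight_neg y
  · exact (hasDerivAt_cuspWeight h).continuousAt

theorem continuousOn_cuspWeight : ContinuousOn cuspWeight {0}ᶜ := fun _ hx =>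
  (continuousAt_cuspWeight hx).continuousWithinAt

/-- A coordinate on `(0, ∞)` running over all of `ℝ`, with derivative at most `2 / (1 - u²)`. -/
noncomputable def cuspCoord (x : ℝ) : ℝ := x - cuspSlope x

theorem hasDerivAt_cuspCoord {x : ℝ} (hx : 0 < x) :
    HasDerivAt cuspCoord (1 + uCusp x / cuspWeight x) x := by
  refine HasDerivAt.congr_deriv (f := cuspCoord)
    ((hasDerivAt_id x).sub (hasDerivAt_cuspSlope hx)) ?_
  ring

theorem cuspCoord_deriv_bounds {x : ℝ} (hx : 0 < x) :
    0 ≤ 1 + uCusp x / cuspWeight x ∧ 1 + uCusp x / cuspWeight x ≤ 2 / cuspWeight x := by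
  have ha := cuspWeight_pos hx.ne'
  have hu := uCusp_mem x
  have h1 : 0 ≤ uCusp x / cuspWeight x := div_nonneg hu.1.le ha.le
  refine ⟨by linarith, ?_⟩
  rw [le_div_iff₀ ha, add_mul, div_mul_cancel₀ _ ha.ne']
  linarith [cuspWeight_le_one x, hu.2]

theorem cuspWeight_le_of_le {x y : ℝ} (hx : 0 < x) (h : x ≤ y) : cuspWeight x ≤ cuspWeight y := by
  have hu : uCusp y ≤ uCusp x := by
    apply uCusp_le_of_abs_le
    rwa [abs_of_pos hx, abs_of_pos (hx.trans_le h)]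
  unfold cuspWeight
  have := (uCusp_mem y).1
  gcongr

theorem cuspSlope_le_of_le {x y : ℝ} (hx : 0 < x) (h : x ≤ y) : cuspSlope y ≤ cuspSlope x :=
  Real.sqrt_le_sqrt (neg_le_neg
    (Real.log_le_log (cuspWeight_pos hx.ne') (cuspWeight_le_of_le hx h)))

theorem exists_cuspCoord_ge (M : ℝ) : ∃ x, 1 ≤ x ∧ M ≤ cuspCoord x := by
  refine ⟨max 1 (M + cuspSlope 1), le_max_left _ _, ?_⟩
  have := cuspSlope_le_of_le one_pos (le_max_left 1 (M + cuspSlope 1))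
  have := le_max_right 1 (M + cuspSlope 1)
  unfold cuspCoord
  linarith

/-- The slope blows up at the origin, so the coordinate reaches -∞ there; a cutoff in this
coordinate can therefore vanish before x reaches 0. -/
theorem exists_cuspCoord_le (M : ℝ) : ∃ x, 0 < x ∧ x ≤ 1 ∧ cuspCoord x ≤ -M := by
  set N : ℝ := |M| + 1 with hN
  have hN0 : 0 < N := by positivity
  have he : Real.exp (-N ^ 2) < 1 := Real.exp_lt_one_iff.2 (by nlinarith)
  -- σ is the value of u at which -log(1 - σ²) = N², so that the slope there equals N.
  set σ : ℝ := Real.sqrt (1 - Real.exp (-N ^ 2)) with hσ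
  have hσ2 : σ ^ 2 = 1 - Real.exp (-N ^ 2) := Real.sq_sqrt (by linarith)
  have hσ0 : 0 < σ := Real.sqrt_pos.2 (by linarith)
  have hσ1 : σ < 1 := by nlinarith [Real.exp_pos (-N ^ 2)]
  have hσm : σ ∈ Ioc (0 : ℝ) 1 := ⟨hσ0, hσ1.le⟩
  set x₀ : ℝ := ∫ ξ in σ..1, cuspIntegrand ξ with hx₀
  have hx0 : 0 < x₀ := by
    have := cuspIntegral_strictAntiOn hσm one_mem_Ioc_cusp hσ1
    simpa using this
  have hp : cuspSlope x₀ = N := by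
    rw [cuspSlope, cuspWeight, uCusp_integral hσm, hσ2, sub_sub_cancel, Real.log_exp,
      neg_neg, Real.sqrt_sq hN0.le]
  have hm : 0 < min x₀ 1 := lt_min hx0 one_pos
  refine ⟨min x₀ 1, hm, min_le_right _ _, ?_⟩
  have h1 := cuspSlope_le_of_le hm (min_le_left x₀ 1)
  have h2 := min_le_right x₀ 1
  have h3 := le_abs_self M
  unfold cuspCoord
  linarith

theorem exists_uCusp_le {δ : ℝ} (hδ : 0 < δ) : ∃ X : ℝ, 0 < X ∧ ∀ x, X ≤ x → uCusp x ≤ δ := by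
  set s := min δ 1
  have hs : s ∈ Ioc (0 : ℝ) 1 := ⟨lt_min hδ one_pos, min_le_right _ _⟩
  refine ⟨max 1 (∫ ξ in s..1, cuspIntegrand ξ), by positivity, fun x hx => ?_⟩
  refine le_trans ((uCusp_le_iff hs).2 ?_) (min_le_left _ _)
  exact ((le_max_right _ _).trans hx).trans (le_abs_self x)

/-! ### The du Bois-Reymond lemma on the half line -/

/-- Real test functions on `(0, ∞)`. -/
structure IsHalfLineTest (φ : ℝ → ℝ) : Prop where
  contDiff : ContDiff ℝ ∞ φ
  hasCompactSupport : HasCompactSupport φ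
  tsupport_subset : tsupport φ ⊆ Ioi 0

namespace IsHalfLineTest

variable {φ ψ : ℝ → ℝ}

theorem sub_const_mul (hφ : IsHalfLineTest φ) (hψ : IsHalfLineTest ψ) (c : ℝ) :
    IsHalfLineTest (fun x => φ x - c * ψ x) where
  contDiff := hφ.contDiff.sub (contDiff_const.mul hψ.contDiff)
  hasCompactSupport := hφ.hasCompactSupport.sub hψ.hasCompactSupport.mul_left
  tsupport_subset := (tsupport_sub φ _).trans
    (union_subset hφ.tsupport_subset ((tsupport_mul_subset_right).trans hψ.tsupport_subset))

theorem test_deriv (hφ : IsHalfLineTest φ) : IsHalfLineTest (deriv φ) where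
  contDiff := (contDiff_infty_iff_deriv.1 hφ.contDiff).2
  hasCompactSupport := hφ.hasCompactSupport.deriv
  tsupport_subset := (closure_mono support_deriv_subset).trans
    ((isClosed_tsupport φ).closure_eq.subset.trans hφ.tsupport_subset)

theorem differentiable (hφ : IsHalfLineTest φ) : Differentiable ℝ φ :=
  hφ.contDiff.differentiable (by simp)

theorem integrable (hφ : IsHalfLineTest φ) : Integrable φ :=
  hφ.contDiff.continuous.integrable_of_hasCompactSupport hφ.hasCompactSupport

theorem exists_Icc (hφ : IsHalfLineTest φ) :
    ∃ α β : ℝ, 0 < α ∧ α ≤ β ∧ ∀ x, x ∉ Icc α β → φ x = 0 := by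
  rcases (tsupport φ).eq_empty_or_nonempty with h | h
  · exact ⟨1, 1, one_pos, le_rfl, fun x _ => image_eq_zero_of_notMem_tsupport (by simp [h])⟩
  · have hc : IsCompact (tsupport φ) := hφ.hasCompactSupport
    obtain ⟨α, hα, hα'⟩ := hc.exists_isLeast h
    obtain ⟨β, hβ, hβ'⟩ := hc.exists_isGreatest h
    refine ⟨α, β, hφ.tsupport_subset hα, hα' hβ, fun x hx => ?_⟩
    exact image_eq_zero_of_notMem_tsupport fun hxs => hx ⟨hα' hxs, hβ' hxs⟩

theorem of_eq_zero (hφ : ContDiff ℝ ∞ φ) {α β : ℝ} (hα : 0 < α)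
    (h : ∀ x, x ∉ Icc α β → φ x = 0) : IsHalfLineTest φ where
  contDiff := hφ
  hasCompactSupport := HasCompactSupport.intro isCompact_Icc h
  tsupport_subset := by
    have h1 : Function.support φ ⊆ Icc α β := fun x hx => by
      by_contra h2
      exact hx (h x h2)
    exact (closure_minimal h1 isClosed_Icc).trans fun x hx => hα.trans_le hx.1

/-- The primitive from 0 vanishes to the left of the support, and zero mean makes it vanish to the
right as well. -/
theorem exists_deriv_eq (hφ : IsHalfLineTest φ) (h0 : ∫ x, φ x = 0) :
    ∃ ψ, IsHalfLineTest ψ ∧ deriv ψ = φ := by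
  obtain ⟨α, β, hα, hαβ, hz⟩ := hφ.exists_Icc
  have hcont := hφ.contDiff.continuous
  have hd : ∀ x, HasDerivAt (fun x => ∫ t in (0 : ℝ)..x, φ t) (φ x) x := fun x =>
    intervalIntegral.integral_hasDerivAt_right (hcont.intervalIntegrable _ _)
      (hcont.stronglyMeasurableAtFilter _ _) hcont.continuousAt
  have hde : deriv (fun x => ∫ t in (0 : ℝ)..x, φ t) = φ := funext fun x => (hd x).deriv
  refine ⟨_, of_eq_zero ?_ hα (β := β) ?_, hde⟩
  · rw [contDiff_infty_iff_deriv, hde]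
    exact ⟨fun x => (hd x).differentiableAt, hφ.contDiff⟩
  · intro x hx
    rcases lt_or_ge x α with h | h
    · rw [intervalIntegral.integral_congr (g := fun _ => 0)]
      · simp
      · intro t ht
        refine hz t fun h' => ?_
        have := ht.2.trans (max_le hα.le h.le)
        rcases le_total 0 x with h0 | h0
        · rw [uIcc_of_le h0] at ht
          exact absurd (h'.1.trans ht.2) (not_le.2 h)
        · rw [uIcc_of_ge h0] at ht
          exact absurd (h'.1.trans ht.2) (not_le.2 hα)
    · have hβ : β < x := by
        by_contra h'
        exact hx ⟨h, not_lt.1 h'⟩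
      rw [intervalIntegral.integral_of_le (hα.le.trans h)]
      refine Eq.trans ?_ h0
      refine setIntegral_eq_integral_of_forall_compl_eq_zero ?_
      intro t ht
      refine hz t fun h' => ht ⟨?_, h'.2.trans hβ.le⟩
      exact hα.trans_le h'.1

theorem exists_integral_eq_one : ∃ θ, IsHalfLineTest θ ∧ ∫ x, θ x = 1 := by
  let f : ContDiffBump (2 : ℝ) := ⟨1 / 2, 1, by norm_num, by norm_num⟩
  refine ⟨f.normed volume, ⟨f.contDiff_normed, f.hasCompactSupport_normed, ?_⟩,
    f.integral_normed⟩
  rw [f.tsupport_normed_eq, Real.closedBall_eq_Icc]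
  intro x hx
  have : (2 : ℝ) - 1 ≤ x := hx.1
  exact lt_of_lt_of_le (by norm_num) this

variable {E : Type*} [NormedAddCommGroup E] [NormedSpace ℝ E] {w : ℝ → E}

theorem integrable_smul (hφ : IsHalfLineTest φ) (hw : LocallyIntegrableOn w (Ioi 0)) :
    Integrable fun x => φ x • w x := by
  have hK : IntegrableOn w (tsupport φ) :=
    hw.integrableOn_compact_subset hφ.tsupport_subset hφ.hasCompactSupport
  have h1 : IntegrableOn (fun x => φ x • w x) (tsupport φ) :=
    hK.continuousOn_smul hφ.contDiff.continuous.continuousOn hφ.hasCompactSupport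
  refine (integrableOn_iff_integrable_of_support_subset ?_).1 h1
  exact (Function.support_smul_subset_left φ w).trans (subset_tsupport φ)

end IsHalfLineTest

theorem LocallyIntegrableOn.intervalIntegrable_Ioi {E : Type*} [NormedAddCommGroup E] {w : ℝ → E}
    (hw : LocallyIntegrableOn w (Ioi 0)) {a b : ℝ} (ha : 0 < a) (hb : 0 < b) :
    IntervalIntegrable w volume a b := by
  rw [intervalIntegrable_iff]
  refine (hw.integrableOn_compact_subset (t := uIcc a b) ?_ isCompact_uIcc).mono_set
    uIoc_subset_uIcc
  exact fun x hx => (lt_min ha hb).trans_le hx.1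

section Primitive

variable {E : Type*} [NormedAddCommGroup E] [NormedSpace ℝ E]

theorem continuousOn_primitive_Ioi {w : ℝ → E} (hw : LocallyIntegrableOn w (Ioi 0)) :
    ContinuousOn (fun x => ∫ t in (1 : ℝ)..x, w t) (Ioi 0) := by
  intro x hx
  have hx0 : (0 : ℝ) < x := hx
  set a := min 1 (x / 2)
  set b := max 1 (2 * x)
  have ha : 0 < a := lt_min one_pos (by linarith)
  have hb : 0 < b := lt_of_lt_of_le one_pos (le_max_left _ _)
  have hab : a ≤ b := (min_le_left _ _).trans (le_max_left _ _)
  have hw' := hw.integrableOn_compact_subset (t := uIcc a b)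
    (fun y hy => (lt_min ha hb).trans_le hy.1) isCompact_uIcc
  have h := intervalIntegral.continuousOn_primitive_interval' (a := 1)
    ((intervalIntegrable_iff.2 (hw'.mono_set uIoc_subset_uIcc))) (by
      rw [uIcc_of_le hab]
      exact ⟨min_le_left _ _, le_max_left _ _⟩)
  refine (h.continuousAt ?_).continuousWithinAt
  rw [uIcc_of_le hab]
  refine Icc_mem_nhds ((min_le_right _ _).trans_lt (by linarith)) ?_
  exact lt_of_lt_of_le (by linarith) (le_max_right _ _)

variable [CompleteSpace E]

/-- Integration by parts through Fubini: w is merely integrable, so its primitive need not be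
differentiable anywhere prescribed. -/
theorem integral_deriv_smul_setIntegral_Iic {w : ℝ → E} (hw : Integrable w) {φ : ℝ → ℝ}
    (hφ : ContDiff ℝ 1 φ) (hc : HasCompactSupport φ) :
    ∫ x, deriv φ x • ∫ t in Iic x, w t = -∫ x, φ x • w x := by
  have hφ' : Integrable (deriv φ) :=
    (hφ.continuous_deriv le_rfl).integrable_of_hasCompactSupport hc.deriv
  have hint : Integrable (Function.uncurry fun x t => (Iic x).indicator (fun t => deriv φ x • w t) t)
      (volume.prod volume) := by
    have h1 : Integrable (fun z : ℝ × ℝ => deriv φ z.1 • w z.2) (volume.prod volume) :=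
      hφ'.smul_prod hw
    have hs : MeasurableSet {z : ℝ × ℝ | z.2 ≤ z.1} :=
      measurableSet_le measurable_snd measurable_fst
    refine (h1.indicator hs).congr (Eventually.of_forall fun z => ?_)
    simp only [indicator, mem_ofPred_eq, Function.uncurry, mem_Iic]
  calc ∫ x, deriv φ x • ∫ t in Iic x, w t
      = ∫ x, ∫ t, (Iic x).indicator (fun t => deriv φ x • w t) t := by
        congr 1
        ext x
        rw [integral_indicator measurableSet_Iic, integral_smul]
    _ = ∫ t, ∫ x, (Iic x).indicator (fun t => deriv φ x • w t) t := integral_integral_swap hint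
    _ = ∫ t, -(φ t • w t) := by
        congr 1
        ext t
        have : (fun x => (Iic x).indicator (fun t => deriv φ x • w t) t)
            = (Ici t).indicator fun x => deriv φ x • w t := by
          ext x
          simp only [indicator, mem_Iic, mem_Ici]
        rw [this, integral_indicator measurableSet_Ici, integral_smul_const,
          integral_Ici_eq_integral_Ioi, hc.integral_Ioi_deriv_eq hφ, neg_smul]
    _ = -∫ x, φ x • w x := integral_neg _

/-- On an interval containing the support of φ, the primitive based at 1 differs by a constant from
that of w truncated to the interval, and ∫ φ' = 0 removes the constant. -/
theorem IsHalfLineTest.integral_deriv_smul_primitive {φ : ℝ → ℝ} (hφ : IsHalfLineTest φ)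
    {w : ℝ → E} (hw : LocallyIntegrableOn w (Ioi 0)) :
    ∫ x, deriv φ x • ∫ t in (1 : ℝ)..x, w t = -∫ x, φ x • w x := by
  obtain ⟨α, β, hα, hαβ, hz⟩ := hφ.exists_Icc
  have hφ1 : ContDiff ℝ 1 φ := hφ.contDiff.of_le (by simp)
  have hz' : ∀ x, x ∉ Icc α β → deriv φ x = 0 := fun x hx => by
    have h1 : φ =ᶠ[𝓝 x] fun _ => 0 := by
      filter_upwards [isClosed_Icc.isOpen_compl.mem_nhds hx] with y hy using hz y hy
    rw [h1.deriv_eq, deriv_const]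
  have hwi : IntegrableOn w (Icc α β) :=
    hw.integrableOn_compact_subset (fun x hx => hα.trans_le hx.1) isCompact_Icc
  have hwt : Integrable ((Icc α β).indicator w) := hwi.integrable_indicator measurableSet_Icc
  have h1 := integral_deriv_smul_setIntegral_Iic hwt hφ1 hφ.hasCompactSupport
  have h2 : ∀ x, deriv φ x • ∫ t in (1 : ℝ)..x, w t = deriv φ x • (∫ t in (1 : ℝ)..α, w t)
      + deriv φ x • ∫ t in Iic x, (Icc α β).indicator w t := by
    intro x
    by_cases hx : x ∈ Icc α β
    · rw [← smul_add, ← intervalIntegral.integral_add_adjacent_intervals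
        (LocallyIntegrableOn.intervalIntegrable_Ioi hw one_pos hα)
        (LocallyIntegrableOn.intervalIntegrable_Ioi hw hα (hα.trans_le hx.1)),
        setIntegral_indicator measurableSet_Icc, intervalIntegral.integral_of_le hx.1,
        ← integral_Icc_eq_integral_Ioc]
      congr 4
      ext t
      simp only [mem_Icc, mem_inter_iff, mem_Iic]
      constructor
      · rintro ⟨h1, h2⟩
        exact ⟨h2, h1, h2.trans hx.2⟩
      · rintro ⟨h1, h2, -⟩
        exact ⟨h2, h1⟩
    · simp [hz' x hx]
  have hint2 : Integrable fun x => deriv φ x • ∫ t in Iic x, (Icc α β).indicator w t := by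
    have h3 := hφ.test_deriv.integrable_smul
      ((continuousOn_primitive_Ioi hw).locallyIntegrableOn measurableSet_Ioi)
    refine (h3.sub (hφ.test_deriv.integrable.smul_const (∫ t in (1 : ℝ)..α, w t))).congr
      (Eventually.of_forall fun x => ?_)
    simp only [Pi.sub_apply, h2, add_sub_cancel_left]
  simp_rw [h2]
  rw [integral_add (hφ.test_deriv.integrable.smul_const _) hint2, integral_smul_const, h1,
    integral_eq_zero_of_hasDerivAt_of_integrable
      (fun x => (hφ.differentiable x).hasDerivAt) hφ.test_deriv.integrable hφ.integrable,
    zero_smul, zero_add]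
  congr 1
  apply integral_congr_ae
  refine Eventually.of_forall fun x => ?_
  by_cases hx : x ∈ Icc α β
  · simp [hx]
  · simp [hz x hx]

/-- A locally integrable function on `(0, ∞)` with vanishing weak derivative is constant. -/
theorem exists_ae_eq_const_of_integral_deriv_smul_eq_zero {f : ℝ → E}
    (hf : LocallyIntegrableOn f (Ioi 0))
    (h : ∀ φ, IsHalfLineTest φ → ∫ x, deriv φ x • f x = 0) :
    ∃ c : E, ∀ᵐ x, x ∈ Ioi (0 : ℝ) → f x = c := by
  obtain ⟨θ, hθ, hθ1⟩ := IsHalfLineTest.exists_integral_eq_one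
  refine ⟨∫ x, θ x • f x, ?_⟩
  have := isOpen_Ioi.ae_eq_zero_of_integral_contDiff_smul_eq_zero (μ := volume)
    (f := fun x => f x - ∫ x, θ x • f x) (U := Ioi (0 : ℝ))
    (hf.sub ((locallyIntegrable_const _).locallyIntegrableOn _)) ?_
  · filter_upwards [this] with x hx hx0 using sub_eq_zero.1 (hx hx0)
  · intro φ h1 h2 h3
    have hφ : IsHalfLineTest φ := ⟨h1, h2, h3⟩
    -- Subtracting (∫ φ)θ leaves a test function of mean zero, hence a derivative, to which the
    -- hypothesis applies.
    obtain ⟨ψ, hψ, hψ'⟩ := (hφ.sub_const_mul hθ (∫ x, φ x)).exists_deriv_eq (by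
      rw [integral_sub hφ.integrable (hθ.integrable.const_mul _), integral_const_mul, hθ1, mul_one,
        sub_self])
    have h4 := h ψ hψ
    simp only [hψ', sub_smul, mul_smul] at h4
    rw [integral_sub (hφ.integrable_smul hf) ((hθ.integrable_smul hf).fun_smul _), integral_smul] at h4
    simp only [smul_sub]
    rw [integral_sub (hφ.integrable_smul hf) (hφ.integrable.smul_const _), integral_smul_const]
    exact h4

/-- A locally integrable function on `(0, ∞)` with a locally integrable weak second derivative
agrees almost everywhere with a twofold primitive of that derivative. -/
theorem exists_ae_eq_primitive_of_integral_deriv_deriv_smul {v w : ℝ → E}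
    (hv : LocallyIntegrableOn v (Ioi 0)) (hw : LocallyIntegrableOn w (Ioi 0))
    (h : ∀ φ, IsHalfLineTest φ → ∫ x, deriv (deriv φ) x • v x = ∫ x, φ x • w x) :
    ∃ c d : E, ∀ᵐ x, x ∈ Ioi (0 : ℝ) →
      v x = c + ∫ t in (1 : ℝ)..x, ((∫ τ in (1 : ℝ)..t, w τ) - d) := by
  obtain ⟨θ, hθ, hθ1⟩ := IsHalfLineTest.exists_integral_eq_one
  set W : ℝ → E := fun t => ∫ τ in (1 : ℝ)..t, w τ with hW
  have hWl : LocallyIntegrableOn W (Ioi 0) :=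
    (continuousOn_primitive_Ioi hw).locallyIntegrableOn measurableSet_Ioi
  -- The constant is forced: v' = W - d in the weak sense, tested against θ with ∫ θ = 1, determines
  -- d.
  set d : E := (∫ x, deriv θ x • v x) + ∫ x, θ x • W x with hd
  have hWd : LocallyIntegrableOn (fun t => W t - d) (Ioi 0) :=
    hWl.sub ((locallyIntegrable_const _).locallyIntegrableOn _)
  have key : ∀ ψ, IsHalfLineTest ψ →
      ∫ x, deriv ψ x • v x = -∫ x, ψ x • (W x - d) := by
    intro ψ hψ
    obtain ⟨η, hη, hη'⟩ := (hψ.sub_const_mul hθ (∫ x, ψ x)).exists_deriv_eq (by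
      rw [integral_sub hψ.integrable (hθ.integrable.const_mul _), integral_const_mul, hθ1, mul_one,
        sub_self])
    have h1 := h η hη
    have h2 := hη.integral_deriv_smul_primitive hw
    have h3 : deriv (deriv η) = fun x => deriv ψ x - (∫ x, ψ x) * deriv θ x := by
      rw [hη']
      ext x
      rw [deriv_fun_sub (hψ.differentiable x) ((hθ.differentiable x).const_mul _),
        deriv_const_mul_field]
    rw [h3] at h1
    rw [hη'] at h2
    simp only [sub_smul, mul_smul] at h1 h2
    rw [integral_sub (hψ.test_deriv.integrable_smul hv) ((hθ.test_deriv.integrable_smul hv).fun_smul _),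
      integral_smul] at h1
    rw [integral_sub (hψ.integrable_smul hWl) ((hθ.integrable_smul hWl).fun_smul _),
      integral_smul] at h2
    simp only [smul_sub]
    rw [integral_sub (hψ.integrable_smul hWl) (hψ.integrable.smul_const _), integral_smul_const, hd,
      smul_add]
    rw [← neg_eq_iff_eq_neg] at h2
    rw [← h2] at h1
    rw [sub_eq_iff_eq_add.1 h1]
    abel
  obtain ⟨c, hc⟩ := exists_ae_eq_const_of_integral_deriv_smul_eq_zero
    (f := fun x => v x - ∫ t in (1 : ℝ)..x, (W t - d))
    (hv.sub ((continuousOn_primitive_Ioi hWd).locallyIntegrableOn measurableSet_Ioi)) (by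
      intro φ hφ
      have h1 := key φ hφ
      have h2 := hφ.integral_deriv_smul_primitive hWd
      simp only [smul_sub (deriv φ _)]
      rw [integral_sub (hφ.test_deriv.integrable_smul hv) (hφ.test_deriv.integrable_smul
        ((continuousOn_primitive_Ioi hWd).locallyIntegrableOn measurableSet_Ioi)), h1, h2, sub_self])
  refine ⟨c, d, ?_⟩
  filter_upwards [hc] with x hx hx0
  rw [← hx hx0, sub_add_cancel]

theorem hasDerivAt_primitive_Ioi {g : ℝ → E} (hg : ContinuousOn g (Ioi 0)) {x : ℝ} (hx : 0 < x) :
    HasDerivAt (fun x => ∫ t in (1 : ℝ)..x, g t) (g x) x :=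
  intervalIntegral.integral_hasDerivAt_right
    (LocallyIntegrableOn.intervalIntegrable_Ioi (hg.locallyIntegrableOn measurableSet_Ioi) one_pos hx)
    (hg.stronglyMeasurableAtFilter isOpen_Ioi x hx) (hg.continuousAt (Ioi_mem_nhds hx))

end Primitive

/-- Weak solutions on `(0, ∞)` of `v'' = q v` with continuous `q` are classical solutions. -/
theorem exists_classical_solution {𝕜 : Type*} [RCLike 𝕜] {v w q : ℝ → 𝕜}
    (hv : LocallyIntegrableOn v (Ioi 0)) (hw : LocallyIntegrableOn w (Ioi 0))
    (hq : ContinuousOn q (Ioi 0)) (hwq : ∀ᵐ x, x ∈ Ioi (0 : ℝ) → w x = q x * v x)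
    (h : ∀ φ, IsHalfLineTest φ → ∫ x, deriv (deriv φ) x • v x = ∫ x, φ x • w x) :
    ∃ y y₁ : ℝ → 𝕜, (∀ᵐ x, x ∈ Ioi (0 : ℝ) → v x = y x) ∧
      ∀ x, 0 < x → HasDerivAt y (y₁ x) x ∧ HasDerivAt y₁ (q x * y x) x := by
  obtain ⟨c, d, hcd⟩ := exists_ae_eq_primitive_of_integral_deriv_deriv_smul hv hw h
  have hWc := continuousOn_primitive_Ioi hw
  have hWd : ContinuousOn (fun t => (∫ τ in (1 : ℝ)..t, w τ) - d) (Ioi 0) :=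
    hWc.sub continuousOn_const
  set y : ℝ → 𝕜 := fun x => c + ∫ t in (1 : ℝ)..x, ((∫ τ in (1 : ℝ)..t, w τ) - d) with hy
  have hyd : ∀ x, 0 < x → HasDerivAt y ((∫ τ in (1 : ℝ)..x, w τ) - d) x := fun x hx =>
    (hasDerivAt_primitive_Ioi hWd hx).const_add c
  have hyc : ContinuousOn y (Ioi 0) := fun x hx => (hyd x hx).continuousAt.continuousWithinAt
  -- Bootstrapping: replacing v by its continuous representative y makes the integrand q y
  -- continuous, so the primitive becomes differentiable at every point.
  have hWy : ∀ x, 0 < x → ∫ τ in (1 : ℝ)..x, w τ = ∫ τ in (1 : ℝ)..x, q τ * y τ := by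
    intro x hx
    apply intervalIntegral.integral_congr_ae
    filter_upwards [hcd, hwq] with t h1 h2 ht
    have ht0 : t ∈ Ioi (0 : ℝ) := (lt_min one_pos hx).trans ht.1
    rw [h2 ht0, h1 ht0]
  refine ⟨y, fun x => (∫ τ in (1 : ℝ)..x, w τ) - d, hcd, fun x hx => ⟨hyd x hx, ?_⟩⟩
  have h1 := (hasDerivAt_primitive_Ioi (hq.mul hyc) hx).sub_const d
  refine h1.congr_of_eventuallyEq ?_
  filter_upwards [Ioi_mem_nhds hx] with t ht
  rw [hWy t ht]
  rfl

/-! ### Solutions of the homogeneous equation -/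

theorem monotoneOn_cuspCoord : MonotoneOn cuspCoord (Ioi 0) := by
  apply monotoneOn_of_deriv_nonneg (convex_Ioi 0)
  · exact fun x hx => (hasDerivAt_cuspCoord hx).continuousAt.continuousWithinAt
  · rw [interior_Ioi]
    exact fun x hx => (hasDerivAt_cuspCoord hx).differentiableAt.differentiableWithinAt
  · rw [interior_Ioi]
    intro x hx
    rw [(hasDerivAt_cuspCoord hx).deriv]
    exact (cuspCoord_deriv_bounds hx).1

theorem exists_cuspCoord_eq (M : ℝ) : ∃ x, 0 < x ∧ cuspCoord x = M := by
  obtain ⟨β, hβ, hβM⟩ := exists_cuspCoord_ge M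
  obtain ⟨α, hα, hα1, hαM⟩ := exists_cuspCoord_le (-M)
  rw [neg_neg] at hαM
  have hc : ContinuousOn cuspCoord (Icc α β) := fun x hx =>
    (hasDerivAt_cuspCoord (hα.trans_le hx.1)).continuousAt.continuousWithinAt
  obtain ⟨x, hx, hxM⟩ := intermediate_value_Icc (hα1.trans hβ) hc ⟨hαM, hβM⟩
  exact ⟨x, hα.trans_le hx.1, hxM⟩

/-! ### Energy identity and cutoff at infinity and at the origin. -/

section Energy

variable {𝕜 : Type*} [RCLike 𝕜] {y y₁ q : ℝ → 𝕜}

theorem hasDerivAt_re_mul_conj {κ : 𝕜} {x : ℝ}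
    (hy : HasDerivAt y (y₁ x) x) (hy₁ : HasDerivAt y₁ (q x * y x) x) :
    HasDerivAt (fun x => RCLike.re (κ * y₁ x * conj (y x)))
      (RCLike.re (κ * q x) * ‖y x‖ ^ 2 + RCLike.re κ * ‖y₁ x‖ ^ 2) x := by
  have h1 : HasDerivAt (fun x => conj (y x)) (conj (y₁ x)) x :=
    (RCLike.conjCLE (K := 𝕜)).toContinuousLinearMap.hasFDerivAt.comp_hasDerivAt x hy
  have h2 := (hy₁.const_mul κ).mul h1
  have h3 := (RCLike.reCLM (K := 𝕜)).hasFDerivAt.comp_hasDerivAt x h2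
  refine HasDerivAt.congr_deriv h3 ?_
  simp only [RCLike.reCLM_apply, map_add]
  have e1 : κ * (q x * y x) * conj (y x) = κ * q x * ((‖y x‖ ^ 2 : ℝ) : 𝕜) := by
    rw [RCLike.ofReal_pow, ← RCLike.mul_conj]
    ring
  have e2 : κ * y₁ x * conj (y₁ x) = κ * ((‖y₁ x‖ ^ 2 : ℝ) : 𝕜) := by
    rw [RCLike.ofReal_pow, ← RCLike.mul_conj]
    ring
  rw [e1, e2, RCLike.re_mul_ofReal, RCLike.re_mul_ofReal]

/-- Integrate (χ² G)' with G = Re(κ y' conj y) and χ = 1 - (s/M)². The main part of the derivative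
dominates c χ²(|y|²/a² + |y'|²), while |χ'| ≤ 4/(aM) lets the cross term be absorbed at the price of
M⁻²|y|²/a². -/
theorem integral_cutoff_le {κ : 𝕜} {c : ℝ} (hc : 0 < c) (hκ : c ≤ RCLike.re κ)
    (hq : ∀ x, 0 < x → c ≤ RCLike.re (κ * q x) * cuspWeight x ^ 2)
    (hy : ∀ x, 0 < x → HasDerivAt y (y₁ x) x ∧ HasDerivAt y₁ (q x * y x) x)
    {M : ℝ} (hM : 0 < M) {α β : ℝ} (hα : 0 < α) (hαβ : α ≤ β)
    (hαM : cuspCoord α = -M) (hβM : cuspCoord β = M) :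
    ∫ x in α..β, (c * (1 - (cuspCoord x / M) ^ 2) ^ 2 - 16 * ‖κ‖ ^ 2 / c / M ^ 2) *
      (‖y x‖ ^ 2 / cuspWeight x ^ 2) ≤ 0 := by
  set χ : ℝ → ℝ := fun x => 1 - (cuspCoord x / M) ^ 2 with hχ
  set G : ℝ → ℝ := fun x => RCLike.re (κ * y₁ x * conj (y x)) with hG
  have hsd : ∀ x, 0 < x → HasDerivAt χ
      (-(2 * (cuspCoord x / M) * ((1 + uCusp x / cuspWeight x) / M))) x := by
    intro x hx
    refine HasDerivAt.congr_deriv ((((hasDerivAt_cuspCoord hx).div_const M).pow 2).const_sub 1) ?_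
    ring
  have hd : ∀ x, 0 < x → HasDerivAt (fun x => χ x ^ 2 * G x)
      (2 * χ x * (-(2 * (cuspCoord x / M) * ((1 + uCusp x / cuspWeight x) / M))) * G x
        + χ x ^ 2 * (RCLike.re (κ * q x) * ‖y x‖ ^ 2 + RCLike.re κ * ‖y₁ x‖ ^ 2)) x := by
    intro x hx
    refine HasDerivAt.congr_deriv
      (((hsd x hx).pow 2).mul (hasDerivAt_re_mul_conj (κ := κ) (hy x hx).1 (hy x hx).2)) ?_
    simp only [Pi.pow_apply, hG]
    ring
  have hpos : ∀ x ∈ Icc α β, 0 < x := fun x hx => hα.trans_le hx.1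
  have hcont : ContinuousOn (fun x => (c * χ x ^ 2 - 16 * ‖κ‖ ^ 2 / c / M ^ 2) *
      (‖y x‖ ^ 2 / cuspWeight x ^ 2)) (Icc α β) := by
    have h1 : ContinuousOn χ (Icc α β) := fun x hx =>
      (hsd x (hpos x hx)).continuousAt.continuousWithinAt
    have h2 : ContinuousOn y (Icc α β) := fun x hx =>
      (hy x (hpos x hx)).1.continuousAt.continuousWithinAt
    have h3 : ContinuousOn cuspWeight (Icc α β) :=
      continuousOn_cuspWeight.mono fun x hx => (hpos x hx).ne'
    refine ((continuousOn_const.mul (h1.pow 2)).sub continuousOn_const).mul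
      ((h2.norm.pow 2).div (h3.pow 2) fun x hx => ?_)
    exact pow_ne_zero 2 (cuspWeight_pos (hpos x hx).ne').ne'
  have key := intervalIntegral.integral_le_sub_of_hasDeriv_right_of_le hαβ
    (g := fun x => χ x ^ 2 * G x)
    (fun x hx => (hd x (hpos x hx)).continuousAt.continuousWithinAt)
    (fun x hx => (hd x (hpos x (Ioo_subset_Icc_self hx))).hasDerivWithinAt)
    (hcont.integrableOn_Icc) ?_
  -- The cutoff vanishes at both endpoints, so there are no boundary terms.
  · refine key.trans (le_of_eq ?_)
    simp only [hχ, hαM, hβM]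
    rw [neg_div, div_self hM.ne']
    norm_num
  · intro x hx
    have hx0 : 0 < x := hpos x (Ioo_subset_Icc_self hx)
    have ha := cuspWeight_pos hx0.ne'
    obtain ⟨hs0, hs1⟩ := cuspCoord_deriv_bounds hx0
    set s' := 1 + uCusp x / cuspWeight x
    set a := cuspWeight x
    have hcoord : |cuspCoord x / M| ≤ 1 := by
      rw [abs_div, abs_of_pos hM, div_le_one hM, abs_le]
      constructor
      · rw [← hαM]
        exact monotoneOn_cuspCoord hα hx0 hx.1.le
      · rw [← hβM]
        exact monotoneOn_cuspCoord hx0 (hα.trans_le hαβ) hx.2.le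
    set τ := cuspCoord x / M
    have hχ' : |2 * τ * (s' / M)| ≤ 4 / (a * M) := by
      rw [abs_mul, abs_mul, abs_two, abs_of_nonneg (div_nonneg hs0 hM.le)]
      calc 2 * |τ| * (s' / M) ≤ 2 * 1 * (2 / a / M) := by gcongr
        _ = 4 / (a * M) := by field_simp; norm_num
    have hGx : |G x| ≤ ‖κ‖ * ‖y₁ x‖ * ‖y x‖ := by
      refine (RCLike.abs_re_le_norm _).trans (le_of_eq ?_)
      rw [norm_mul, norm_mul, RCLike.norm_conj]
    have h1 : |2 * χ x * (-(2 * τ * (s' / M))) * G x|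
        ≤ 2 * |χ x| * (4 / (a * M)) * (‖κ‖ * ‖y₁ x‖ * ‖y x‖) := by
      rw [abs_mul, abs_mul, abs_mul, abs_two, abs_neg]
      gcongr
    -- Weighted arithmetic-geometric mean: 2AB ≤ cA² + B²/c, where cA² is exactly the available
    -- gradient term.
    have h2 : 2 * |χ x| * (4 / (a * M)) * (‖κ‖ * ‖y₁ x‖ * ‖y x‖)
        ≤ c * (χ x ^ 2 * ‖y₁ x‖ ^ 2) + 16 * ‖κ‖ ^ 2 / c / M ^ 2 * (‖y x‖ ^ 2 / a ^ 2) := by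
      set A := |χ x| * ‖y₁ x‖
      set B := 4 * ‖κ‖ * ‖y x‖ / (a * M) with hB
      have e1 : 2 * |χ x| * (4 / (a * M)) * (‖κ‖ * ‖y₁ x‖ * ‖y x‖) = 2 * A * B := by
        simp only [A, B]; ring
      have e2 : χ x ^ 2 * ‖y₁ x‖ ^ 2 = A ^ 2 := by
        simp only [A, mul_pow, sq_abs]
      have e3 : 16 * ‖κ‖ ^ 2 / c / M ^ 2 * (‖y x‖ ^ 2 / a ^ 2) = B ^ 2 / c := by
        rw [hB]; field_simp; ring
      rw [e1, e2, e3]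
      have h4 : 0 ≤ (c * A - B) ^ 2 / c := by positivity
      have h5 : (c * A - B) ^ 2 / c = c * A ^ 2 + B ^ 2 / c - 2 * A * B := by
        field_simp
        ring
      linarith
    have h3 : c * (‖y x‖ ^ 2 / a ^ 2) ≤ RCLike.re (κ * q x) * ‖y x‖ ^ 2 := by
      have := hq x hx0
      rw [mul_div_assoc', div_le_iff₀ (by positivity)]
      calc c * ‖y x‖ ^ 2 ≤ RCLike.re (κ * q x) * a ^ 2 * ‖y x‖ ^ 2 := by gcongr
        _ = _ := by ring
    have h4 : c * ‖y₁ x‖ ^ 2 ≤ RCLike.re κ * ‖y₁ x‖ ^ 2 := by gcongr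
    have h5 := mul_le_mul_of_nonneg_left (add_le_add h3 h4) (sq_nonneg (χ x))
    have h6 := neg_abs_le (2 * χ x * (-(2 * τ * (s' / M))) * G x)
    linarith

/-- Letting M → ∞ in the cutoff inequality leaves c∫|y|²/a² ≤ 0. The proof is quantitative: a
nonzero value of y gives a fixed mass δ on [x₀, x₀ + 1], which a large M contradicts. -/
theorem classical_solution_eq_zero {κ : 𝕜} {c : ℝ} (hc : 0 < c) (hκ : c ≤ RCLike.re κ)
    (hq : ∀ x, 0 < x → c ≤ RCLike.re (κ * q x) * cuspWeight x ^ 2)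
    (hy : ∀ x, 0 < x → HasDerivAt y (y₁ x) x ∧ HasDerivAt y₁ (q x * y x) x)
    (hI : IntegrableOn (fun x => ‖y x‖ ^ 2 / cuspWeight x ^ 2) (Ioi 0)) :
    ∀ x, 0 < x → y x = 0 := by
  intro x₀ hx₀
  by_contra hne
  set N : ℝ → ℝ := fun x => ‖y x‖ ^ 2 / cuspWeight x ^ 2 with hN
  have hN0 : ∀ x, 0 ≤ N x := fun x => by positivity
  have hNc : ContinuousOn N (Ioi 0) := by
    refine ContinuousOn.div (fun x hx => ?_) (fun x hx => ?_) fun x hx => ?_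
    · exact ((hy x hx).1.continuousAt.norm.pow 2).continuousWithinAt
    · exact ((continuousAt_cuspWeight (ne_of_gt hx)).pow 2).continuousWithinAt
    · exact pow_ne_zero 2 (cuspWeight_pos (ne_of_gt hx)).ne'
  set δ := ∫ x in x₀..(x₀ + 1), N x with hδdef
  have hδ : 0 < δ := by
    apply intervalIntegral.integral_pos (by linarith)
      (hNc.mono fun x hx => hx₀.trans_le hx.1) (fun x _ => hN0 x)
    refine ⟨x₀, ⟨le_rfl, by linarith⟩, ?_⟩
    have := cuspWeight_pos hx₀.ne'
    have := norm_pos_iff.2 hne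
    positivity
  set I := ∫ x in Ioi 0, N x with hIdef
  set C := 16 * ‖κ‖ ^ 2 / c with hC
  have hC0 : 0 ≤ C := by positivity
  set S := |cuspCoord x₀| + |cuspCoord (x₀ + 1)| + 1 with hS
  have hS0 : 0 < S := by positivity
  -- M ≥ 2S keeps |s/M| ≤ 1/2, hence χ² ≥ 1/2, on [x₀, x₀ + 1]; the last entry, with M ≥ 1, makes
  -- cδ/2 ≤ CI/M² impossible.
  set M := max (max 1 (2 * S)) (2 * (C * I + 1) / (c * δ)) with hM
  have hM1 : 1 ≤ M := (le_max_left _ _).trans (le_max_left _ _)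
  have hM2 : 2 * S ≤ M := (le_max_right _ _).trans (le_max_left _ _)
  have hM3 : 2 * (C * I + 1) ≤ M * (c * δ) := by
    rw [← div_le_iff₀ (by positivity)]
    exact le_max_right _ _
  obtain ⟨α, hα, hαM⟩ := exists_cuspCoord_eq (-M)
  obtain ⟨β, hβ, hβM⟩ := exists_cuspCoord_eq M
  have hx1 : 0 < x₀ + 1 := by linarith
  have hs0 : |cuspCoord x₀| < S := by
    have := abs_nonneg (cuspCoord (x₀ + 1))
    linarith
  have hs1 : |cuspCoord (x₀ + 1)| < S := by
    have := abs_nonneg (cuspCoord x₀)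
    linarith
  have hαx : α ≤ x₀ := by
    by_contra h
    have := monotoneOn_cuspCoord hx₀ hα (not_le.1 h).le
    linarith [neg_abs_le (cuspCoord x₀)]
  have hxβ : x₀ + 1 ≤ β := by
    by_contra h
    have := monotoneOn_cuspCoord hβ hx1 (not_le.1 h).le
    linarith [le_abs_self (cuspCoord (x₀ + 1))]
  have hαβ : α ≤ β := by linarith
  have key := integral_cutoff_le hc hκ hq hy (by linarith : 0 < M) hα hαβ hαM hβM
  have hcoord : ContinuousOn cuspCoord (Ioi 0) := fun x hx =>
    (hasDerivAt_cuspCoord hx).continuousAt.continuousWithinAt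
  set P : ℝ → ℝ := fun x => c * (1 - (cuspCoord x / M) ^ 2) ^ 2 * N x with hP
  have hPc : ContinuousOn P (Ioi 0) :=
    (continuousOn_const.mul ((continuousOn_const.sub ((hcoord.div_const M).pow 2)).pow 2)).mul hNc
  have hint : ∀ {f : ℝ → ℝ}, ContinuousOn f (Ioi 0) → ∀ {s t : ℝ}, 0 < s → 0 < t →
      IntervalIntegrable f volume s t := fun hf s t hs ht =>
    LocallyIntegrableOn.intervalIntegrable_Ioi (hf.locallyIntegrableOn measurableSet_Ioi) hs ht
  have hsplit : ∫ x in α..β, P x ≤ C / M ^ 2 * ∫ x in α..β, N x := by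
    rw [← intervalIntegral.integral_const_mul, ← sub_nonpos, ← intervalIntegral.integral_sub
      (hint hPc hα hβ) ((hint hNc hα hβ).const_mul _)]
    simpa only [hP, sub_mul] using key
  have hNI : ∫ x in α..β, N x ≤ I := by
    rw [intervalIntegral.integral_of_le hαβ]
    exact setIntegral_mono_set hI (ae_of_all _ hN0)
      (Eventually.of_forall fun x (hx : x ∈ Ioc α β) => hα.trans hx.1)
  have hlow : c / 2 * δ ≤ ∫ x in α..β, P x := by
    calc c / 2 * δ = ∫ x in x₀..(x₀ + 1), c / 2 * N x := by
          rw [intervalIntegral.integral_const_mul]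
      _ ≤ ∫ x in x₀..(x₀ + 1), P x := by
          apply intervalIntegral.integral_mono_on (by linarith)
            ((hint hNc hx₀ hx1).const_mul _) (hint hPc hx₀ hx1)
          intro x hx
          have hx0 : 0 < x := hx₀.trans_le hx.1
          have h1 := monotoneOn_cuspCoord hx₀ hx0 hx.1
          have h2 := monotoneOn_cuspCoord hx0 hx1 hx.2
          have h3 : |cuspCoord x| ≤ S := abs_le.2
            ⟨by linarith [neg_abs_le (cuspCoord x₀)], by linarith [le_abs_self (cuspCoord (x₀ + 1))]⟩
          have h4 : |cuspCoord x / M| ≤ 1 / 2 := by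
            rw [abs_div, abs_of_pos (by linarith : 0 < M), div_le_iff₀ (by linarith)]
            linarith
          have h5 : (cuspCoord x / M) ^ 2 ≤ 1 / 4 := by
            rw [← sq_abs]
            nlinarith [abs_nonneg (cuspCoord x / M)]
          have h6 : (1 : ℝ) / 2 ≤ (1 - (cuspCoord x / M) ^ 2) ^ 2 := by nlinarith
          simp only [hP]
          have := hN0 x
          calc c / 2 * N x = c * (1 / 2) * N x := by ring
            _ ≤ _ := by gcongr
      _ ≤ ∫ x in α..β, P x := by
          apply intervalIntegral.integral_mono_interval hαx (by linarith) hxβ _ (hint hPc hα hβ)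
          exact ae_of_all _ fun x => mul_nonneg (mul_nonneg hc.le (sq_nonneg _)) (hN0 x)
  have hfin : c / 2 * δ ≤ C / M ^ 2 * I :=
    hlow.trans (hsplit.trans (mul_le_mul_of_nonneg_left hNI (by positivity)))
  rw [div_mul_eq_mul_div C, le_div_iff₀ (by positivity)] at hfin
  have hcδ : 0 < c * δ := by positivity
  nlinarith [mul_le_mul_of_nonneg_left hM1 (by positivity : 0 ≤ c * δ * M)]

end Energy

/-! ### Coercivity of the rotated potential and injectivity of L - z. -/

section Injectivity

variable {𝕜 : Type} [RCLike 𝕜]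

/-- The potential `q` for which `L v = z v` reads `v'' = q v`. -/
noncomputable def cuspPotential (z : 𝕜) (x : ℝ) : 𝕜 :=
  (((1 + uCusp x ^ 2) / cuspWeight x ^ 2 : ℝ) : 𝕜) - z * ((cuspWeight x)⁻¹ : ℝ)

theorem cuspPotential_neg (z : 𝕜) (x : ℝ) : cuspPotential z (-x) = cuspPotential z x := by
  simp only [cuspPotential, uCusp_neg, cuspWeight_neg]

theorem continuousOn_cuspPotential (z : 𝕜) : ContinuousOn (cuspPotential z) (Ioi 0) := by
  have ha : ContinuousOn cuspWeight (Ioi 0) :=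
    continuousOn_cuspWeight.mono fun x hx => ne_of_gt hx
  have hne : ∀ x ∈ Ioi (0 : ℝ), cuspWeight x ≠ 0 := fun x hx => (cuspWeight_pos (ne_of_gt hx)).ne'
  have hu : ContinuousOn uCusp (Ioi 0) := fun x hx =>
    (hasDerivAt_uCusp hx).continuousAt.continuousWithinAt
  refine ContinuousOn.sub ?_ (continuousOn_const.mul ?_)
  · exact RCLike.continuous_ofReal.comp_continuousOn
      ((continuousOn_const.add (hu.pow 2)).div (ha.pow 2) fun x hx => pow_ne_zero 2 (hne x hx))
  · exact RCLike.continuous_ofReal.comp_continuousOn (ha.inv₀ hne)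

/-- Off (-∞, 0], the multiplier |ζ| + conj ζ has argument -arg(ζ)/2, so it turns 1 and ζ
symmetrically into the right half plane. -/
theorem RCLike.re_multiplier_mul (ζ : 𝕜) :
    RCLike.re ((((‖ζ‖ : ℝ) : 𝕜) + conj ζ) * ζ) = ‖ζ‖ * (‖ζ‖ + RCLike.re ζ) := by
  rw [add_mul, RCLike.conj_mul, map_add, RCLike.re_ofReal_mul, ← RCLike.ofReal_pow,
    RCLike.ofReal_re]
  ring

theorem RCLike.re_multiplier (ζ : 𝕜) :
    RCLike.re (((‖ζ‖ : ℝ) : 𝕜) + conj ζ) = ‖ζ‖ + RCLike.re ζ := by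
  simp

theorem one_le_two_mul_sq_add_cuspWeight (x : ℝ) : 1 ≤ 2 * uCusp x ^ 2 + cuspWeight x := by
  unfold cuspWeight
  nlinarith [sq_nonneg (uCusp x)]

/-- The symbol `1 + u² - z (1 - u²)`, i.e. `(1 - u²)²` times the potential. -/
noncomputable def cuspSymbol (z : 𝕜) (x : ℝ) : 𝕜 :=
  ((2 * uCusp x ^ 2 : ℝ) : 𝕜) + (1 - z) * (cuspWeight x : ℝ)

theorem ofReal_cuspWeight (x : ℝ) : (cuspWeight x : 𝕜) = 1 - (uCusp x : 𝕜) ^ 2 := by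
  simp [cuspWeight]

theorem cuspPotential_mul_sq (z : 𝕜) {x : ℝ} (hx : x ≠ 0) :
    cuspPotential z x * ((cuspWeight x ^ 2 : ℝ) : 𝕜) = cuspSymbol z x := by
  have h2 : (cuspWeight x : 𝕜) ≠ 0 := RCLike.ofReal_ne_zero.2 (cuspWeight_pos hx).ne'
  simp only [cuspPotential, cuspSymbol, RCLike.ofReal_div, RCLike.ofReal_pow, RCLike.ofReal_inv]
  field_simp
  push_cast
  rw [ofReal_cuspWeight]
  ring

/-- The symbol is a combination of 1 and 1 - z with nonnegative weights 2u² and a, whose sum is 1 +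
u² ≥ 1; both are rotated to real parts at least r·min(1, |1 - z|), with r = |1 - z| + Re(1 - z). -/
theorem le_re_multiplier_mul_cuspSymbol {z : 𝕜} (hz : 0 < ‖1 - z‖ + RCLike.re (1 - z)) (x : ℝ) :
    (‖1 - z‖ + RCLike.re (1 - z)) * min 1 ‖1 - z‖ ≤
      RCLike.re ((((‖1 - z‖ : ℝ) : 𝕜) + conj (1 - z)) * cuspSymbol z x) := by
  have ha := cuspWeight_nonneg x
  set κ : 𝕜 := ((‖1 - z‖ : ℝ) : 𝕜) + conj (1 - z)
  rw [cuspSymbol, mul_add, ← mul_assoc, map_add, RCLike.re_mul_ofReal,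
    RCLike.re_mul_ofReal, RCLike.re_multiplier, RCLike.re_multiplier_mul]
  set r := ‖1 - z‖ + RCLike.re (1 - z)
  have h4 : min 1 ‖1 - z‖ ≤ 1 := min_le_left _ _
  have h5 : min 1 ‖1 - z‖ ≤ ‖1 - z‖ := min_le_right _ _
  have h6 : 0 ≤ min 1 ‖1 - z‖ := le_min zero_le_one (norm_nonneg _)
  calc r * min 1 ‖1 - z‖ ≤ r * (min 1 ‖1 - z‖ * (2 * uCusp x ^ 2 + cuspWeight x)) := by
        gcongr
        exact le_mul_of_one_le_right h6 (one_le_two_mul_sq_add_cuspWeight x)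
    _ ≤ r * (1 * (2 * uCusp x ^ 2) + ‖1 - z‖ * cuspWeight x) := by
        rw [mul_add]
        gcongr
    _ = _ := by ring

theorem norm_one_sub_pos {z : 𝕜} (hz : 0 < ‖1 - z‖ + RCLike.re (1 - z)) : 0 < ‖1 - z‖ := by
  have := RCLike.re_le_norm (1 - z)
  linarith

theorem ae_eq_zero_of_weak_solution {z : 𝕜} (hz : 0 < ‖1 - z‖ + RCLike.re (1 - z)) {v : ℝ → 𝕜}
    (hv : LocallyIntegrableOn v (Ioi 0))
    (h : ∀ φ, IsHalfLineTest φ →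
      ∫ x, deriv (deriv φ) x • v x = ∫ x, φ x • (cuspPotential z x * v x))
    (hI : IntegrableOn (fun x => ‖v x‖ ^ 2 / cuspWeight x ^ 2) (Ioi 0)) :
    ∀ᵐ x, x ∈ Ioi (0 : ℝ) → v x = 0 := by
  obtain ⟨y, y₁, hvy, hy⟩ := exists_classical_solution hv
    (hv.continuousOn_smul isOpen_Ioi.isLocallyClosed (continuousOn_cuspPotential z))
    (continuousOn_cuspPotential z) (ae_of_all _ fun _ _ => rfl) h
  have hy0 := classical_solution_eq_zero (κ := ((‖1 - z‖ : ℝ) : 𝕜) + conj (1 - z))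
    (c := (‖1 - z‖ + RCLike.re (1 - z)) * min 1 ‖1 - z‖)
    (mul_pos hz (lt_min one_pos (norm_one_sub_pos hz)))
    (by
      rw [RCLike.re_multiplier]
      exact mul_le_of_le_one_right hz.le (min_le_left _ _))
    (fun x hx => by
      rw [← RCLike.re_mul_ofReal, mul_assoc, cuspPotential_mul_sq z hx.ne']
      exact le_re_multiplier_mul_cuspSymbol hz x) hy
    (hI.congr_fun_ae ((ae_restrict_iff' measurableSet_Ioi).2 (by
      filter_upwards [hvy] with x hx hx0
      simp only [hx hx0])))
  filter_upwards [hvy] with x hx hx0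
  rw [hx hx0, hy0 x hx0]

theorem iteratedDeriv_two (φ : ℝ → ℝ) : iteratedDeriv 2 φ = deriv (deriv φ) := by
  rw [iteratedDeriv_succ, iteratedDeriv_one]

/-- An eigenfunction solves v'' = q v on each half line separately. The evenness of u reduces the
negative half line to the positive one. -/
theorem eq_zero_of_mem_newtonGraph {z : 𝕜} (hz : 0 < ‖1 - z‖ + RCLike.re (1 - z))
    {v : Lp 𝕜 2 (volume : Measure ℝ)} (hv : (v, z • v) ∈ newtonGraph 𝕜 uCusp) : v = 0 := by
  obtain ⟨w, hw, -, hb, heq⟩ := hv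
  simp only at hw hb heq
  have hne : ∀ᵐ x : ℝ, x ≠ 0 := by simp [ae_iff]
  have hwq : ∀ᵐ x, w x = cuspPotential z x * v x := by
    filter_upwards [heq, Lp.coeFn_smul z v, hne] with x h1 h2 hx
    rw [h2, Pi.smul_apply, smul_eq_mul] at h1
    have ha : (cuspWeight x : 𝕜) ≠ 0 := RCLike.ofReal_ne_zero.2 (cuspWeight_pos hx).ne'
    change z * v x = -(cuspWeight x • w x) + ((1 + uCusp x ^ 2) / cuspWeight x) • v x at h1
    rw [RCLike.real_smul_eq_coe_mul, RCLike.real_smul_eq_coe_mul] at h1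
    apply mul_left_cancel₀ ha
    rw [cuspPotential]
    simp only [RCLike.ofReal_div, RCLike.ofReal_pow, RCLike.ofReal_inv] at h1 ⊢
    have h3 : (cuspWeight x : 𝕜) * w x =
      ((1 + uCusp x ^ 2 : ℝ) : 𝕜) / cuspWeight x * v x - z * v x := by
      rw [h1]
      ring
    rw [h3]
    field_simp
  have hvm : MemLp v 2 volume := Lp.memLp v
  have hmp : MeasurePreserving (fun x : ℝ => -x) volume volume := ⟨measurable_neg, Measure.neg_eq_self _⟩
  -- The potential term of the domain controls v/a, because 1 + u² ≥ 1.
  have hI : Integrable fun x => ‖v x‖ ^ 2 / cuspWeight x ^ 2 := by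
    refine ((memLp_two_iff_integrable_sq_norm hb.1).1 hb).mono' ?_ ?_
    · exact ((hvm.1.norm.aemeasurable.pow_const 2).div
        (measurable_cuspWeight.pow_const 2).aemeasurable).aestronglyMeasurable
    · filter_upwards [hne] with x hx
      have ha := cuspWeight_pos hx
      change _ ≤ ‖((1 + uCusp x ^ 2) / cuspWeight x) • v x‖ ^ 2
      rw [Real.norm_of_nonneg (by positivity), norm_smul, mul_pow, Real.norm_of_nonneg (by positivity),
        div_pow, div_mul_eq_mul_div]
      gcongr
      apply le_mul_of_one_le_left (sq_nonneg _)
      nlinarith [sq_nonneg (uCusp x), sq_nonneg (uCusp x ^ 2)]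
  have hpos : ∀ᵐ x, x ∈ Ioi (0 : ℝ) → v x = 0 := by
    refine ae_eq_zero_of_weak_solution hz
      ((hvm.locallyIntegrable (by norm_num)).locallyIntegrableOn _) (fun φ hφ => ?_)
      hI.integrableOn
    rw [← iteratedDeriv_two, hw.2 φ hφ.contDiff hφ.hasCompactSupport
      (hφ.tsupport_subset.trans fun x hx => ne_of_gt hx)]
    apply integral_congr_ae
    filter_upwards [hwq] with x hx
    rw [hx]
  have hneg : ∀ᵐ x, x ∈ Ioi (0 : ℝ) → v (-x) = 0 := by
    refine ae_eq_zero_of_weak_solution (v := fun x => v (-x)) hz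
      (((hvm.comp_measurePreserving hmp).locallyIntegrable (by norm_num)).locallyIntegrableOn _)
      (fun φ hφ => ?_) ?_
    · have h1 := hw.2 (fun x => φ (-x)) (hφ.contDiff.comp contDiff_neg)
        (hφ.hasCompactSupport.comp_homeomorph (Homeomorph.neg ℝ)) (by
          have := tsupport_comp_eq_preimage φ (Homeomorph.neg ℝ)
          change tsupport (φ ∘ (Homeomorph.neg ℝ)) ⊆ _
          rw [this]
          intro x hx h0
          have h0' : x = 0 := h0
          have h2 : (0 : ℝ) < -x := hφ.tsupport_subset hx
          linarith)
      have h2 : iteratedDeriv 2 (fun x => φ (-x)) = fun x => iteratedDeriv 2 φ (-x) := by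
        ext x
        rw [iteratedDeriv_comp_neg]
        simp
      rw [h2] at h1
      rw [← iteratedDeriv_two, ← integral_neg_eq_self]
      simp only [neg_neg]
      rw [h1, ← integral_neg_eq_self]
      simp only [neg_neg]
      apply integral_congr_ae
      filter_upwards [hmp.quasiMeasurePreserving.ae hwq] with x hx
      rw [hx, cuspPotential_neg]
    · have := (hmp.integrable_comp hI.1).2 hI
      refine this.integrableOn.congr_fun (fun x _ => ?_) measurableSet_Ioi
      simp only [Function.comp_apply, cuspWeight_neg]
  apply Lp.ext
  filter_upwards [hpos, hmp.quasiMeasurePreserving.ae hneg, hne, Lp.coeFn_zero 𝕜 2 (volume : Measure ℝ)]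
    with x h1 h2 h3 h4
  rw [h4, Pi.zero_apply]
  rcases h3.lt_or_gt with h | h
  · have := h2 (neg_pos.2 h)
    rwa [neg_neg] at this
  · exact h1 h

end Injectivity

/-! ### An abstract Lax–Milgram lemma. -/

section HilbertSpace

variable {𝕜 E F : Type*} [RCLike 𝕜] [NormedAddCommGroup E] [InnerProductSpace 𝕜 E]
  [NormedAddCommGroup F] [InnerProductSpace 𝕜 F] [CompleteSpace E] [CompleteSpace F]

/-- Lax–Milgram on a closed subspace of `E × F`, for the form
`⟪p₁, m x₁⟫ + ⟪p₂, x₂⟫` and right-hand sides `⟪p₁, f⟫`. -/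
theorem exists_laxMilgram_solution (K : Submodule 𝕜 (WithLp 2 (E × F))) (m : E →L[𝕜] E) {κ : 𝕜}
    {c : ℝ} (hc : 0 < c) (hκ : c ≤ RCLike.re κ)
    (hm : ∀ g, c * ‖g‖ ^ 2 ≤ RCLike.re (κ * inner 𝕜 g (m g))) :
    ∃ S : E →L[𝕜] WithLp 2 (E × F), ∀ f, S f ∈ Kᗮ ∧ ∀ p ∈ Kᗮ,
      inner 𝕜 p.fst (m (S f).fst) + inner 𝕜 p.snd (S f).snd = inner 𝕜 p.fst f := by
  set e := WithLp.prodContinuousLinearEquiv 2 𝕜 E F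
  let M : WithLp 2 (E × F) →L[𝕜] WithLp 2 (E × F) :=
    e.symm.toContinuousLinearMap ∘L (m.prodMap (ContinuousLinearMap.id 𝕜 F)) ∘L
      e.toContinuousLinearMap
  have hM : ∀ p x, inner 𝕜 p (M x) = inner 𝕜 p.fst (m x.fst) + inner 𝕜 p.snd x.snd :=
    fun p x => rfl
  let T : Kᗮ →L[𝕜] Kᗮ := Kᗮ.orthogonalProjectionOnto ∘L M ∘L Kᗮ.subtypeL
  have hT : ∀ p x : Kᗮ, inner 𝕜 p (T x) = inner 𝕜 (p : WithLp 2 (E × F)) (M x) := fun p x =>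
    Submodule.inner_orthogonalProjectionOnto_eq_of_mem_left p (M x)
  have hκ0 : 0 < ‖κ‖ := hc.trans_le (hκ.trans (RCLike.re_le_norm κ))
  -- Coercivity of Re(κ⟪x, Tx⟫) bounds |⟪Tx, x⟫| below by (c/‖κ‖)‖x‖², which makes T invertible.
  have hunit : IsUnit T := by
    refine ContinuousLinearMap.isUnit_of_forall_le_norm_inner_map T
      (c := (c / ‖κ‖).toNNReal) (Real.toNNReal_pos.2 (div_pos hc hκ0)) fun x => ?_
    rw [Real.coe_toNNReal _ (div_pos hc hκ0).le, norm_inner_symm, hT, hM,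
      mul_div_assoc', div_le_iff₀ hκ0, mul_comm _ ‖κ‖, ← norm_mul]
    refine le_trans ?_ (RCLike.re_le_norm _)
    have h1 : ‖x‖ ^ 2 = ‖(x : WithLp 2 (E × F)).fst‖ ^ 2 + ‖(x : WithLp 2 (E × F)).snd‖ ^ 2 :=
      WithLp.prod_norm_sq_eq_of_L2 _
    rw [h1, mul_add κ, map_add, inner_self_eq_norm_sq_to_K, ← RCLike.ofReal_pow,
      RCLike.re_mul_ofReal, add_mul]
    refine add_le_add ?_ ?_
    · rw [mul_comm]
      exact hm _
    · rw [mul_comm]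
      gcongr
  obtain ⟨⟨T, S, hTS, hST⟩, rfl⟩ := hunit
  -- The functional p ↦ ⟪p₁, f⟫ is represented on the closed subspace by the projection of (f, 0).
  refine ⟨Kᗮ.subtypeL ∘L S ∘L Kᗮ.orthogonalProjectionOnto ∘L e.symm.toContinuousLinearMap ∘L
    ContinuousLinearMap.inl 𝕜 E F, fun f => ⟨Submodule.coe_mem _, fun p hp => ?_⟩⟩
  set r := Kᗮ.orthogonalProjectionOnto (e.symm (f, 0)) with hr
  change inner 𝕜 p.fst (m ((S r : Kᗮ) : WithLp 2 (E × F)).fst)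
    + inner 𝕜 p.snd ((S r : Kᗮ) : WithLp 2 (E × F)).snd = _
  rw [← hM]
  have h1 : T (S r) = r := by
    rw [← mul_apply_eq_comp, hTS, one_apply_eq_self]
  have h2 := hT ⟨p, hp⟩ (S r)
  simp only at h2
  rw [← h2, h1, hr, Submodule.inner_orthogonalProjectionOnto_eq_of_mem_left]
  change inner 𝕜 p.fst f + inner 𝕜 p.snd (0 : F) = _
  rw [inner_zero_right, add_zero]

end HilbertSpace

/-! ### Multiplication operators on L². -/

section Multiplication

variable {𝕜 : Type} [RCLike 𝕜]

theorem MemLp.bounded_mul {m : ℝ → 𝕜} (hm : AEStronglyMeasurable m volume) {C : ℝ}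
    (hC : ∀ x, ‖m x‖ ≤ C) {g : ℝ → 𝕜} (hg : MemLp g 2 volume) :
    MemLp (fun x => m x * g x) 2 volume := by
  refine hg.of_le_mul (c := C) (hm.mul hg.1) (ae_of_all _ fun x => ?_)
  rw [norm_mul]
  gcongr
  exact hC x

/-- Multiplication by a bounded measurable function, as a bounded operator on `L²(ℝ)`. -/
noncomputable def mulL2 (m : ℝ → 𝕜) (hm : AEStronglyMeasurable m volume) (C : ℝ)
    (hC : ∀ x, ‖m x‖ ≤ C) :
    Lp 𝕜 2 (volume : Measure ℝ) →L[𝕜] Lp 𝕜 2 (volume : Measure ℝ) :=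
  LinearMap.mkContinuous
    { toFun := fun g => (MemLp.bounded_mul hm hC (Lp.memLp g)).toLp _
      map_add' := fun g g' => by
        apply Lp.ext
        filter_upwards [MemLp.coeFn_toLp (MemLp.bounded_mul hm hC (Lp.memLp (g + g'))),
          MemLp.coeFn_toLp (MemLp.bounded_mul hm hC (Lp.memLp g)),
          MemLp.coeFn_toLp (MemLp.bounded_mul hm hC (Lp.memLp g')), Lp.coeFn_add g g',
          Lp.coeFn_add ((MemLp.bounded_mul hm hC (Lp.memLp g)).toLp _)
            ((MemLp.bounded_mul hm hC (Lp.memLp g')).toLp _)] with x h1 h2 h3 h4 h5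
        rw [h1, h5, Pi.add_apply, h2, h3, h4, Pi.add_apply, mul_add]
      map_smul' := fun c g => by
        apply Lp.ext
        filter_upwards [MemLp.coeFn_toLp (MemLp.bounded_mul hm hC (Lp.memLp (c • g))),
          MemLp.coeFn_toLp (MemLp.bounded_mul hm hC (Lp.memLp g)), Lp.coeFn_smul c g,
          Lp.coeFn_smul c ((MemLp.bounded_mul hm hC (Lp.memLp g)).toLp _)] with x h1 h2 h3 h4
        rw [RingHom.id_apply, h1, h4, Pi.smul_apply, h2, h3, Pi.smul_apply, smul_eq_mul,
          smul_eq_mul, mul_left_comm] } C fun g => by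
    apply Lp.norm_le_mul_norm_of_ae_le_mul
    filter_upwards [MemLp.coeFn_toLp (MemLp.bounded_mul hm hC (Lp.memLp g))] with x hx
    change ‖(MemLp.bounded_mul hm hC (Lp.memLp g)).toLp _ x‖ ≤ _
    rw [hx, norm_mul]
    gcongr
    exact hC x

theorem coeFn_mulL2 {m : ℝ → 𝕜} (hm : AEStronglyMeasurable m volume) {C : ℝ}
    (hC : ∀ x, ‖m x‖ ≤ C) (g : Lp 𝕜 2 (volume : Measure ℝ)) :
    mulL2 m hm C hC g =ᵐ[volume] fun x => m x * g x :=
  MemLp.coeFn_toLp (MemLp.bounded_mul hm hC (Lp.memLp g))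

theorem norm_sq_eq_integral (g : Lp 𝕜 2 (volume : Measure ℝ)) : ‖g‖ ^ 2 = ∫ x, ‖g x‖ ^ 2 := by
  rw [← inner_self_eq_norm_sq (𝕜 := 𝕜), L2.inner_def, ← integral_re (L2.integrable_inner g g)]
  simp only [inner_self_eq_norm_sq]

theorem le_re_mul_inner_mulL2 {m : ℝ → 𝕜} (hm : AEStronglyMeasurable m volume) {C : ℝ}
    (hC : ∀ x, ‖m x‖ ≤ C) {κ : 𝕜} {c : ℝ} (hκ : ∀ x, c ≤ RCLike.re (κ * m x))
    (g : Lp 𝕜 2 (volume : Measure ℝ)) :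
    c * ‖g‖ ^ 2 ≤ RCLike.re (κ * inner 𝕜 g (mulL2 m hm C hC g)) := by
  have hi : Integrable fun x => κ * inner 𝕜 (g x) (mulL2 m hm C hC g x) :=
    (L2.integrable_inner g (mulL2 m hm C hC g)).const_mul κ
  rw [norm_sq_eq_integral, L2.inner_def, ← integral_const_mul, ← integral_const_mul,
    ← integral_re hi]
  apply integral_mono_ae
  · exact ((memLp_two_iff_integrable_sq_norm (Lp.memLp g).1).1 (Lp.memLp g)).const_mul c
  · exact hi.re
  · filter_upwards [coeFn_mulL2 hm hC g] with x hx
    have h2 : κ * inner 𝕜 (g x) (mulL2 m hm C hC g x) = κ * m x * ((‖g x‖ ^ 2 : ℝ) : 𝕜) := by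
      rw [hx, RCLike.inner_apply, mul_assoc (m x), RCLike.mul_conj, RCLike.ofReal_pow, mul_assoc]
    simp only [h2]
    rw [RCLike.re_mul_ofReal]
    gcongr
    exact hκ x

theorem inner_toLp_ofReal {ψ : ℝ → ℝ} (hψ : MemLp (fun x => (ψ x : 𝕜)) 2 volume)
    (g : Lp 𝕜 2 (volume : Measure ℝ)) : inner 𝕜 (hψ.toLp _) g = ∫ x, ψ x • g x := by
  rw [L2.inner_def]
  apply integral_congr_ae
  filter_upwards [hψ.coeFn_toLp] with x hx
  rw [hx, RCLike.inner_apply, RCLike.conj_ofReal, RCLike.real_smul_eq_coe_mul, mul_comm]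

end Multiplication

/-- Real test functions on `ℝ \ {0}`. -/
structure IsPuncturedTest (φ : ℝ → ℝ) : Prop where
  contDiff : ContDiff ℝ ∞ φ
  hasCompactSupport : HasCompactSupport φ
  tsupport_subset : tsupport φ ⊆ {0}ᶜ

namespace IsPuncturedTest

variable {φ ψ : ℝ → ℝ}

theorem test_deriv (hφ : IsPuncturedTest φ) : IsPuncturedTest (deriv φ) where
  contDiff := (contDiff_infty_iff_deriv.1 hφ.contDiff).2
  hasCompactSupport := hφ.hasCompactSupport.deriv
  tsupport_subset := (closure_mono support_deriv_subset).trans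
    ((isClosed_tsupport φ).closure_eq.subset.trans hφ.tsupport_subset)

theorem continuous (hφ : IsPuncturedTest φ) : Continuous φ := hφ.contDiff.continuous

theorem hasDerivAt (hφ : IsPuncturedTest φ) (x : ℝ) : HasDerivAt φ (deriv φ x) x :=
  (hφ.contDiff.differentiable (by simp) x).hasDerivAt

theorem apply_zero (hφ : IsPuncturedTest φ) : φ 0 = 0 :=
  image_eq_zero_of_notMem_tsupport fun h => hφ.tsupport_subset h rfl

/-- The singularity of 1/a sits only at 0, and φ vanishes in a neighbourhood of 0. -/
theorem continuous_div_cuspWeight (hφ : IsPuncturedTest φ) :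
    Continuous fun x => φ x / cuspWeight x := by
  rw [continuous_iff_continuousAt]
  intro x
  by_cases hx : x = 0
  · have h1 : φ =ᶠ[𝓝 x] 0 := by
      rw [← notMem_tsupport_iff_eventuallyEq]
      exact fun h => hφ.tsupport_subset h hx
    have h2 : (fun x => φ x / cuspWeight x) =ᶠ[𝓝 x] fun _ => 0 := by
      filter_upwards [h1] with y hy
      simp [hy]
    exact continuousAt_const.congr h2.symm
  · exact hφ.continuous.continuousAt.div (continuousAt_cuspWeight hx) (cuspWeight_pos hx).ne'

variable (𝕜 : Type) [RCLike 𝕜]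

theorem memLp (hφ : IsPuncturedTest φ) : MemLp (fun x => (φ x : 𝕜)) 2 volume :=
  (RCLike.continuous_ofReal.comp hφ.continuous).memLp_of_hasCompactSupport
    (hφ.hasCompactSupport.comp_left RCLike.ofReal_zero)

theorem memLp_div_cuspWeight (hφ : IsPuncturedTest φ) :
    MemLp (fun x => ((φ x / cuspWeight x : ℝ) : 𝕜)) 2 volume := by
  refine (RCLike.continuous_ofReal.comp
    hφ.continuous_div_cuspWeight).memLp_of_hasCompactSupport ?_
  refine (hφ.hasCompactSupport.mul_right (f' := fun x => (cuspWeight x)⁻¹)).comp_left ?_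
  exact RCLike.ofReal_zero

theorem memLp_cuspWeight_mul (hφ : IsPuncturedTest φ) :
    MemLp (fun x => ((cuspWeight x * φ x : ℝ) : 𝕜)) 2 volume := by
  refine (hφ.memLp 𝕜).mono ?_ (ae_of_all _ fun x => ?_)
  · exact (RCLike.continuous_ofReal.measurable.comp
      (measurable_cuspWeight.mul hφ.continuous.measurable)).aestronglyMeasurable
  · rw [RCLike.norm_ofReal, RCLike.norm_ofReal, abs_mul, abs_of_nonneg (cuspWeight_nonneg x)]
    exact mul_le_of_le_one_left (abs_nonneg _) (cuspWeight_le_one x)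

theorem integral_mul_deriv (hφ : IsPuncturedTest φ) (hψ : IsPuncturedTest ψ) :
    ∫ x, φ x * deriv ψ x = -∫ x, deriv φ x * ψ x := by
  apply integral_mul_deriv_eq_deriv_mul_of_integrable
    (fun x _ => hφ.hasDerivAt x) (fun x _ => hψ.hasDerivAt x)
  · exact (hφ.continuous.mul hψ.test_deriv.continuous).integrable_of_hasCompactSupport
      hφ.hasCompactSupport.mul_right
  · exact (hφ.test_deriv.continuous.mul hψ.continuous).integrable_of_hasCompactSupport
      hψ.hasCompactSupport.mul_left
  · exact (hφ.continuous.mul hψ.continuous).integrable_of_hasCompactSupport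
      hφ.hasCompactSupport.mul_right

end IsPuncturedTest

/-! ### The variational space and construction of the resolvent. -/

section Resolvent

variable (𝕜 : Type) [RCLike 𝕜]

/-- The span of the pairs `((1 - u²) φ', φ)`; its orthogonal complement consists of the pairs
`(g, h)` such that `h` is the weak derivative of `(1 - u²) g` on `ℝ \ {0}`. -/
noncomputable def testPairSpan :
    Submodule 𝕜 (WithLp 2 (Lp 𝕜 2 (volume : Measure ℝ) × Lp 𝕜 2 (volume : Measure ℝ))) :=
  Submodule.span 𝕜 {p | ∃ (φ : ℝ → ℝ) (hφ : IsPuncturedTest φ),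
    p = WithLp.toLp 2 ((hφ.test_deriv.memLp_cuspWeight_mul 𝕜).toLp _, (hφ.memLp 𝕜).toLp _)}

variable {𝕜}

theorem mem_testPairSpan_orthogonal
    {p : WithLp 2 (Lp 𝕜 2 (volume : Measure ℝ) × Lp 𝕜 2 (volume : Measure ℝ))} :
    p ∈ (testPairSpan 𝕜)ᗮ ↔ ∀ φ, IsPuncturedTest φ →
      (∫ x, (cuspWeight x * deriv φ x) • p.fst x) + ∫ x, φ x • p.snd x = 0 := by
  have key : ∀ φ (hφ : IsPuncturedTest φ),
      inner 𝕜 (WithLp.toLp 2 ((hφ.test_deriv.memLp_cuspWeight_mul 𝕜).toLp _,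
        (hφ.memLp 𝕜).toLp _)) p
      = (∫ x, (cuspWeight x * deriv φ x) • p.fst x) + ∫ x, φ x • p.snd x := by
    intro φ hφ
    rw [WithLp.prod_inner_apply]
    exact congrArg₂ _ (inner_toLp_ofReal (hφ.test_deriv.memLp_cuspWeight_mul 𝕜) _)
      (inner_toLp_ofReal (hφ.memLp 𝕜) _)
  constructor
  · intro hp φ hφ
    rw [← key φ hφ]
    exact hp _ (Submodule.subset_span ⟨φ, hφ, rfl⟩)
  · intro h x hx
    induction hx using Submodule.span_induction with
    | mem x hx =>
      obtain ⟨φ, hφ, rfl⟩ := hx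
      rw [key φ hφ, h φ hφ]
    | zero => exact inner_zero_left _
    | add x y _ _ hx hy => rw [inner_add_left, hx, hy, add_zero]
    | smul c x _ hx => rw [inner_smul_left, hx, mul_zero]

/-- These are the pairs (v/a, v') for v = φ. Their membership makes every test function admissible
in the variational identity, so that its solutions solve the equation in the sense of distributions.
-/
theorem testPair_mem_orthogonal {φ : ℝ → ℝ} (hφ : IsPuncturedTest φ) :
    WithLp.toLp 2 ((hφ.memLp_div_cuspWeight 𝕜).toLp _, (hφ.test_deriv.memLp 𝕜).toLp _)
      ∈ (testPairSpan 𝕜)ᗮ := by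
  rw [mem_testPairSpan_orthogonal]
  intro ψ hψ
  have h1 : ∫ x, (cuspWeight x * deriv ψ x) • (hφ.memLp_div_cuspWeight 𝕜).toLp _ x
      = ((∫ x, deriv ψ x * φ x : ℝ) : 𝕜) := by
    rw [← integral_ofReal]
    apply integral_congr_ae
    filter_upwards [(hφ.memLp_div_cuspWeight 𝕜).coeFn_toLp] with x hx
    rw [hx, RCLike.real_smul_eq_coe_mul, ← RCLike.ofReal_mul]
    congr 1
    by_cases h0 : x = 0
    · rw [h0, hφ.apply_zero]
      simp
    · have := cuspWeight_pos h0
      field_simp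
  have h2 : ∫ x, ψ x • (hφ.test_deriv.memLp 𝕜).toLp _ x = ((∫ x, ψ x * deriv φ x : ℝ) : 𝕜) := by
    rw [← integral_ofReal]
    apply integral_congr_ae
    filter_upwards [(hφ.test_deriv.memLp 𝕜).coeFn_toLp] with x hx
    rw [hx, RCLike.real_smul_eq_coe_mul, ← RCLike.ofReal_mul]
  refine (congrArg₂ (· + ·) h1 h2).trans ?_
  rw [hψ.integral_mul_deriv hφ]
  simp

theorem aestronglyMeasurable_ofReal_cuspWeight :
    AEStronglyMeasurable (fun x => (cuspWeight x : 𝕜)) volume :=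
  (RCLike.continuous_ofReal.measurable.comp measurable_cuspWeight).aestronglyMeasurable

theorem norm_ofReal_cuspWeight_le (x : ℝ) : ‖(cuspWeight x : 𝕜)‖ ≤ 1 := by
  rw [RCLike.norm_ofReal, abs_of_nonneg (cuspWeight_nonneg x)]
  exact cuspWeight_le_one x

theorem aestronglyMeasurable_cuspSymbol (z : 𝕜) :
    AEStronglyMeasurable (cuspSymbol z) volume :=
  (RCLike.continuous_ofReal.measurable.comp
    ((measurable_uCusp.pow_const 2).const_mul 2)).aestronglyMeasurable.add
    (aestronglyMeasurable_const.mul aestronglyMeasurable_ofReal_cuspWeight)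

theorem norm_cuspSymbol_le (z : 𝕜) (x : ℝ) : ‖cuspSymbol z x‖ ≤ 2 + ‖1 - z‖ := by
  refine (norm_add_le _ _).trans (add_le_add ?_ ?_)
  · have := uCusp_mem x
    rw [RCLike.norm_ofReal, abs_of_nonneg (by positivity)]
    nlinarith [this.1, this.2]
  · rw [norm_mul]
    exact mul_le_of_le_one_right (norm_nonneg _) (norm_ofReal_cuspWeight_le x)

/-- The resolvent: a bounded operator producing solutions of `L v - z v = f` in the domain. -/
theorem exists_resolvent {z : 𝕜} (hz : 0 < ‖1 - z‖ + RCLike.re (1 - z)) :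
    ∃ R : Lp 𝕜 2 (volume : Measure ℝ) →L[𝕜] Lp 𝕜 2 (volume : Measure ℝ),
      ∀ f, (R f, f + z • R f) ∈ newtonGraph 𝕜 uCusp := by
  set m := mulL2 (cuspSymbol z) (aestronglyMeasurable_cuspSymbol z) _ (norm_cuspSymbol_le z) with hm
  obtain ⟨S, hS⟩ := exists_laxMilgram_solution (testPairSpan 𝕜) m
    (κ := ((‖1 - z‖ : ℝ) : 𝕜) + conj (1 - z))
    (c := (‖1 - z‖ + RCLike.re (1 - z)) * min 1 ‖1 - z‖)
    (mul_pos hz (lt_min one_pos (norm_one_sub_pos hz)))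
    (by
      rw [RCLike.re_multiplier]
      exact mul_le_of_le_one_right hz.le (min_le_left _ _))
    (le_re_mul_inner_mulL2 _ _ (le_re_multiplier_mul_cuspSymbol hz))
  set A := mulL2 (fun x => (cuspWeight x : 𝕜)) aestronglyMeasurable_ofReal_cuspWeight 1
    norm_ofReal_cuspWeight_le with hA
  refine ⟨A ∘L WithLp.fstL 2 𝕜 _ _ ∘L S, fun f => ?_⟩
  obtain ⟨hSf, hp⟩ := hS f
  set g := (S f).fst with hg
  set h := (S f).snd
  change (A g, f + z • A g) ∈ _
  have hAg : A g =ᵐ[volume] fun x => (cuspWeight x : 𝕜) * g x := coeFn_mulL2 _ _ g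
  have hmg : m g =ᵐ[volume] fun x => cuspSymbol z x * g x := coeFn_mulL2 _ _ g
  have hne : ∀ᵐ x : ℝ, x ≠ 0 := by simp [ae_iff]
  rw [mem_testPairSpan_orthogonal] at hSf
  have haw : ∀ᵐ x, cuspWeight x • ((cuspWeight x)⁻¹ • (m g - f : Lp 𝕜 2 (volume : Measure ℝ)) x)
      = (m g - f : Lp 𝕜 2 (volume : Measure ℝ)) x := by
    filter_upwards [hne] with x hx
    rw [smul_smul, mul_inv_cancel₀ (cuspWeight_pos hx).ne', one_smul]
  have hbv : ∀ᵐ x, ((1 + uCusp x ^ 2) / (1 - uCusp x ^ 2)) • A g x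
      = ((1 + uCusp x ^ 2 : ℝ) : 𝕜) * g x := by
    filter_upwards [hAg, hne] with x h1 hx
    have h2 : cuspWeight x ≠ 0 := (cuspWeight_pos hx).ne'
    change ((1 + uCusp x ^ 2) / cuspWeight x) • A g x = _
    rw [h1, RCLike.real_smul_eq_coe_mul, ← mul_assoc, ← RCLike.ofReal_mul, div_mul_cancel₀ _ h2]
  -- The equation forces this second derivative: a v'' = a² q g - f, where v = a g.
  refine ⟨fun x => (cuspWeight x)⁻¹ • (m g - f : Lp 𝕜 2 (volume : Measure ℝ)) x,
    ⟨?_, fun φ h1 h2 h3 => ?_⟩, ?_, ?_, ?_⟩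
  · refine LocallyIntegrableOn.continuousOn_smul isOpen_compl_singleton.isLocallyClosed
      ((((Lp.memLp (m g - f)).locallyIntegrable (by norm_num))).locallyIntegrableOn _)
      (continuousOn_cuspWeight.inv₀ fun x hx => (cuspWeight_pos hx).ne')
  · have hφ : IsPuncturedTest φ := ⟨h1, h2, h3⟩
    have e1 := hSf _ hφ.test_deriv
    have e2 : inner 𝕜 ((hφ.memLp_div_cuspWeight 𝕜).toLp _) (m g)
        + inner 𝕜 ((hφ.test_deriv.memLp 𝕜).toLp _) h
        = inner 𝕜 ((hφ.memLp_div_cuspWeight 𝕜).toLp _) f := hp _ (testPair_mem_orthogonal hφ)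
    rw [inner_toLp_ofReal (hφ.test_deriv.memLp 𝕜)] at e2
    have e3 : ∫ x, iteratedDeriv 2 φ x • A g x
        = ∫ x, (cuspWeight x * deriv (deriv φ) x) • g x := by
      apply integral_congr_ae
      filter_upwards [hAg] with x hx
      rw [hx, iteratedDeriv_two]
      simp only [RCLike.real_smul_eq_coe_mul, RCLike.ofReal_mul]
      ring
    have e4 : ∫ x, φ x • ((cuspWeight x)⁻¹ • (m g - f : Lp 𝕜 2 (volume : Measure ℝ)) x)
        = ∫ x, (φ x / cuspWeight x) • (m g - f : Lp 𝕜 2 (volume : Measure ℝ)) x := by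
      simp only [smul_smul, div_eq_mul_inv]
    refine e3.trans (Eq.trans ?_ e4.symm)
    rw [← inner_toLp_ofReal (hφ.memLp_div_cuspWeight 𝕜), inner_sub_right]
    -- The orthogonality relation tested with φ' gives ∫ φ'' v = -∫ φ' h; the variational identity
    -- tested with φ evaluates the right side.
    linear_combination e1 - e2
  · refine (Lp.memLp (m g - f)).ae_eq ?_
    filter_upwards [haw] with x hx
    exact hx.symm
  · refine MemLp.ae_eq ?_ (MemLp.bounded_mul (m := fun x => ((1 + uCusp x ^ 2 : ℝ) : 𝕜)) (C := 2)
      ?_ (fun x => ?_) (Lp.memLp g))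
    · filter_upwards [hbv] with x hx
      exact hx.symm
    · exact (RCLike.continuous_ofReal.measurable.comp
        ((measurable_uCusp.pow_const 2).const_add 1)).aestronglyMeasurable
    · have := uCusp_mem x
      rw [RCLike.norm_ofReal, abs_of_nonneg (by positivity)]
      nlinarith [this.1, this.2]
  · filter_upwards [haw, hbv, hAg, hmg, Lp.coeFn_add f (z • A g), Lp.coeFn_smul z (A g),
      Lp.coeFn_sub (m g) f] with x h1 h2 h3 h4 h5 h6 h7
    change _ = -(cuspWeight x • _) + _
    rw [h1, h2, h7, Pi.sub_apply, h4, h5, Pi.add_apply, h6, Pi.smul_apply, h3, cuspSymbol,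
      ofReal_cuspWeight]
    push_cast
    rw [smul_eq_mul]
    ring

end Resolvent

/-! ### Bounded inverses of the shifted operator. -/

section Operator

theorem mem_newtonOp_graph {𝕜 : Type} [RCLike 𝕜] {v f : Lp 𝕜 2 (volume : Measure ℝ)} :
    (v, f) ∈ newtonGraph 𝕜 uCusp ↔
      ∃ h : v ∈ (newtonOp 𝕜 uCusp).domain, newtonOp 𝕜 uCusp ⟨v, h⟩ = f := by
  rw [← newtonOp_graph, LinearPMap.mem_graph_iff]
  constructor
  · rintro ⟨⟨y, hy⟩, h1, h2⟩
    simp only at h1 h2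
    subst h1
    exact ⟨hy, h2⟩
  · rintro ⟨h, h'⟩
    exact ⟨⟨v, h⟩, rfl, h'⟩

theorem shiftOp_apply {𝕜 E : Type} [RCLike 𝕜] [NormedAddCommGroup E] [NormedSpace 𝕜 E]
    (A : E →ₗ.[𝕜] E) (z : 𝕜) (v : A.domain) : shiftOp A z v = A v - z • (v : E) := rfl

theorem exists_isBoundedInverse_shiftOp {𝕜 : Type} [RCLike 𝕜] {z : 𝕜}
    (hz : 0 < ‖1 - z‖ + RCLike.re (1 - z)) :
    ∃ R : Lp 𝕜 2 (volume : Measure ℝ) →L[𝕜] Lp 𝕜 2 (volume : Measure ℝ),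
      IsBoundedInverse (shiftOp (newtonOp 𝕜 uCusp) z) R := by
  obtain ⟨R, hR⟩ := exists_resolvent hz
  refine ⟨R, fun f => ?_, fun v => ?_⟩
  · obtain ⟨h1, h2⟩ := mem_newtonOp_graph.1 (hR f)
    exact ⟨h1, (shiftOp_apply (newtonOp 𝕜 uCusp) z ⟨R f, h1⟩).trans (by
      rw [h2, add_sub_cancel_right])⟩
  · rw [shiftOp_apply (newtonOp 𝕜 uCusp) z v]
    set f := newtonOp 𝕜 uCusp v - z • (v : Lp 𝕜 2 (volume : Measure ℝ)) with hf
    have h1 : ((v : Lp 𝕜 2 (volume : Measure ℝ)), newtonOp 𝕜 uCusp v) ∈ newtonGraph 𝕜 uCusp :=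
      mem_newtonOp_graph.2 ⟨v.2, rfl⟩
    -- R((L - z)v) and v solve the same equation, so their difference is an eigenvector for z and
    -- vanishes by injectivity.
    have h2 := (newtonGraph 𝕜 uCusp).sub_mem (hR f) h1
    rw [Prod.mk_sub_mk] at h2
    have h3 : f + z • R f - newtonOp 𝕜 uCusp v
        = z • (R f - (v : Lp 𝕜 2 (volume : Measure ℝ))) := by
      rw [hf, smul_sub]
      abel
    rw [h3] at h2
    exact sub_eq_zero.1 (eq_zero_of_mem_newtonGraph hz h2)

theorem exists_isBoundedInverse_newtonOp (𝕜 : Type) [RCLike 𝕜] :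
    ∃ R : Lp 𝕜 2 (volume : Measure ℝ) →L[𝕜] Lp 𝕜 2 (volume : Measure ℝ),
      IsBoundedInverse (newtonOp 𝕜 uCusp) R := by
  obtain ⟨R, h1, h2⟩ := exists_isBoundedInverse_shiftOp (𝕜 := 𝕜) (z := 0) (by simp)
  refine ⟨R, fun f => ?_, fun v => ?_⟩
  · obtain ⟨h, h'⟩ := h1 f
    have h3 := (shiftOp_apply (newtonOp 𝕜 uCusp) 0 ⟨R f, h⟩).symm.trans h'
    rw [zero_smul, sub_zero] at h3
    exact ⟨h, h3⟩
  · have := h2 v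
    rwa [shiftOp_apply (newtonOp 𝕜 uCusp) 0 v, zero_smul, sub_zero] at this

end Operator

/-! ### Approximate eigenfunctions far from the origin. -/

section Weyl

variable {𝕜 : Type} [RCLike 𝕜]

theorem integral_iteratedDeriv_two_smul {V V₁ V₂ : ℝ → 𝕜} (hV : ∀ x, HasDerivAt V (V₁ x) x)
    (hV₁ : ∀ x, HasDerivAt V₁ (V₂ x) x) (hV₂ : Continuous V₂) {φ : ℝ → ℝ}
    (hφ : IsPuncturedTest φ) :
    ∫ x, iteratedDeriv 2 φ x • V x = ∫ x, φ x • V₂ x := by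
  have hVc : Continuous V := continuous_iff_continuousAt.2 fun x => (hV x).continuousAt
  have hV₁c : Continuous V₁ := continuous_iff_continuousAt.2 fun x => (hV₁ x).continuousAt
  have hint : ∀ {ψ : ℝ → ℝ} {W : ℝ → 𝕜}, IsPuncturedTest ψ → Continuous W →
      Integrable fun x => ψ x • W x := fun hψ hW =>
    (hψ.continuous.smul hW).integrable_of_hasCompactSupport hψ.hasCompactSupport.smul_right
  have h1 := integral_bilinear_hasDerivAt_right_eq_neg_left_of_integrable
    (L := ContinuousLinearMap.lsmul ℝ ℝ) (u := φ) (v := V₁) (fun x _ => hφ.hasDerivAt x)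
    (fun x _ => hV₁ x) (hint hφ hV₂) (hint hφ.test_deriv hV₁c) (hint hφ hV₁c)
  have h2 := integral_bilinear_hasDerivAt_right_eq_neg_left_of_integrable
    (L := ContinuousLinearMap.lsmul ℝ ℝ) (u := deriv φ) (v := V)
    (fun x _ => hφ.test_deriv.hasDerivAt x)
    (fun x _ => hV x) (hint hφ.test_deriv hV₁c) (hint hφ.test_deriv.test_deriv hVc)
    (hint hφ.test_deriv hVc)
  simp only [ContinuousLinearMap.lsmul_apply] at h1 h2
  rw [iteratedDeriv_two, h1, h2, neg_neg]

/-- Twice continuously differentiable functions supported in a compact subset of `(0, ∞)` are in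
the domain of `L`. -/
theorem exists_mem_newtonGraph_of_classical {V V₁ V₂ : ℝ → 𝕜} (hV : ∀ x, HasDerivAt V (V₁ x) x)
    (hV₁ : ∀ x, HasDerivAt V₁ (V₂ x) x) (hV₂ : Continuous V₂) {α β : ℝ} (hα : 0 < α)
    (h0 : ∀ x, x ∉ Icc α β → V x = 0) (h2 : ∀ x, x ∉ Icc α β → V₂ x = 0) :
    ∃ p ∈ newtonGraph 𝕜 uCusp, p.1 =ᵐ[volume] V ∧
      p.2 =ᵐ[volume] fun x => -(cuspWeight x • V₂ x) +
        ((1 + uCusp x ^ 2) / cuspWeight x) • V x := by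
  have hVc : Continuous V := continuous_iff_continuousAt.2 fun x => (hV x).continuousAt
  have hVm : MemLp V 2 volume :=
    hVc.memLp_of_hasCompactSupport (HasCompactSupport.intro isCompact_Icc h0)
  have hV₂m : MemLp V₂ 2 volume :=
    hV₂.memLp_of_hasCompactSupport (HasCompactSupport.intro isCompact_Icc h2)
  have ha : MemLp (fun x => cuspWeight x • V₂ x) 2 volume := by
    refine (MemLp.bounded_mul aestronglyMeasurable_ofReal_cuspWeight norm_ofReal_cuspWeight_le
      hV₂m).ae_eq (ae_of_all _ fun x => ?_)
    simp only [RCLike.real_smul_eq_coe_mul]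
  have hb : MemLp (fun x => ((1 + uCusp x ^ 2) / cuspWeight x) • V x) 2 volume := by
    -- The weight increases on (0, ∞), so its least value on the support is at least its value at α.
    refine hVm.of_le_mul (c := 2 / cuspWeight α) ?_ (ae_of_all _ fun x => ?_)
    · exact ((((measurable_uCusp.pow_const 2).const_add 1).div measurable_cuspWeight).smul
        hVc.measurable).aestronglyMeasurable
    · by_cases hx : x ∈ Icc α β
      · have h3 := cuspWeight_le_of_le hα hx.1
        have h4 := cuspWeight_pos hα.ne'
        have h5 := uCusp_mem x
        rw [norm_smul, Real.norm_of_nonneg (div_nonneg (by positivity) (cuspWeight_nonneg x))]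
        gcongr
        nlinarith [h5.1, h5.2]
      · simp [h0 x hx]
  have hf := ha.neg.add hb
  refine ⟨(hVm.toLp, hf.toLp), ⟨V₂, ⟨(hV₂.locallyIntegrable).locallyIntegrableOn _,
    fun φ p1 p2 p3 => ?_⟩, ha, ?_, ?_⟩, hVm.coeFn_toLp, hf.coeFn_toLp⟩
  · rw [← integral_iteratedDeriv_two_smul hV hV₁ hV₂ ⟨p1, p2, p3⟩]
    apply integral_congr_ae
    filter_upwards [hVm.coeFn_toLp] with x hx
    rw [hx]
  · refine hb.ae_eq ?_
    filter_upwards [hVm.coeFn_toLp] with x hx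
    simp only [hx]
    rfl
  · filter_upwards [hVm.coeFn_toLp, hf.coeFn_toLp] with x hx hx'
    rw [hx, hx']
    rfl

theorem hasCompactSupport_exists_bound {f : ℝ → ℝ} (hf : Continuous f) (hc : HasCompactSupport f) :
    ∃ C, 0 ≤ C ∧ ∀ x, |f x| ≤ C := by
  obtain ⟨C, hC⟩ := hc.exists_bound_of_continuous hf
  exact ⟨C, (norm_nonneg _).trans (hC 0), hC⟩

/-- Wide smooth plateaus with small derivatives. -/
theorem exists_plateau : ∃ C : ℝ, 0 ≤ C ∧ ∀ n c : ℝ, 1 ≤ n → ∃ Φ Φ₁ Φ₂ : ℝ → ℝ,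
    (∀ x, HasDerivAt Φ (Φ₁ x) x) ∧ (∀ x, HasDerivAt Φ₁ (Φ₂ x) x) ∧ Continuous Φ₂ ∧
    (∀ x, |Φ x| ≤ 1) ∧ (∀ x, |Φ₁ x| ≤ C / n) ∧ (∀ x, |Φ₂ x| ≤ C / n) ∧
    (∀ x ∈ Icc (c - n) (c + n), Φ x = 1) ∧
    ∀ x, x ∉ Icc (c - 2 * n) (c + 2 * n) → Φ x = 0 ∧ Φ₁ x = 0 ∧ Φ₂ x = 0 := by
  let b : ContDiffBump (0 : ℝ) := ⟨1, 2, one_pos, one_lt_two⟩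
  have hb : ContDiff ℝ ∞ b := b.contDiff
  have hb' : ContDiff ℝ ∞ (deriv b) := (contDiff_infty_iff_deriv.1 hb).2
  have hb'' : ContDiff ℝ ∞ (deriv (deriv b)) := (contDiff_infty_iff_deriv.1 hb').2
  obtain ⟨C₁, hC₁, h1⟩ := hasCompactSupport_exists_bound hb'.continuous b.hasCompactSupport.deriv
  obtain ⟨C₂, hC₂, h2⟩ := hasCompactSupport_exists_bound hb''.continuous
    b.hasCompactSupport.deriv.deriv
  refine ⟨C₁ + C₂, by positivity, fun n c hn => ?_⟩
  have hn0 : 0 < n := by linarith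
  have hlin : ∀ x, HasDerivAt (fun x => (x - c) / n) (1 / n) x := fun x =>
    ((hasDerivAt_id x).sub_const c).div_const n
  refine ⟨fun x => b ((x - c) / n), fun x => deriv b ((x - c) / n) * (1 / n),
    fun x => deriv (deriv b) ((x - c) / n) * (1 / n) * (1 / n), fun x => ?_, fun x => ?_, ?_,
    fun x => ?_, fun x => ?_, fun x => ?_, fun x hx => ?_, fun x hx => ?_⟩
  · exact (hb.differentiable (by simp) _).hasDerivAt.comp x (hlin x)
  · exact ((hb'.differentiable (by simp) _).hasDerivAt.comp x (hlin x)).mul_const _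
  · have := hb''.continuous
    fun_prop
  · rw [abs_of_nonneg b.nonneg]
    exact b.le_one
  · rw [abs_mul, abs_of_pos (by positivity : 0 < 1 / n), mul_one_div]
    gcongr
    exact (h1 _).trans (by linarith)
  · rw [abs_mul, abs_mul, abs_of_pos (by positivity : 0 < 1 / n), mul_one_div, mul_one_div]
    -- The second derivative is in fact O(n⁻²); the weaker O(1/n) suffices, so one factor is
    -- discarded using n ≥ 1.
    apply div_le_of_le_mul₀ hn0.le (by positivity)
    calc |deriv (deriv b) ((x - c) / n)| / n ≤ (C₁ + C₂) / n := by
          gcongr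
          exact (h2 _).trans (by linarith)
      _ ≤ (C₁ + C₂) / n * n := le_mul_of_one_le_right (by positivity) hn
  · apply b.one_of_mem_closedBall
    rw [mem_closedBall_zero_iff, Real.norm_eq_abs, abs_div, abs_of_pos hn0]
    change _ ≤ (1 : ℝ)
    rw [div_le_one hn0, abs_le]
    constructor <;> linarith [hx.1, hx.2]
  · have h3 : (x - c) / n ∉ tsupport b := by
      rw [b.tsupport_eq, mem_closedBall_zero_iff, Real.norm_eq_abs, abs_div, abs_of_pos hn0]
      change ¬ _ ≤ (2 : ℝ)
      rw [div_le_iff₀ hn0, abs_le]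
      rintro ⟨h3, h4⟩
      exact hx ⟨by linarith, by linarith⟩
    have h4 : (x - c) / n ∉ tsupport (deriv b) := fun h => h3 (tsupport_deriv_subset h)
    have h5 : (x - c) / n ∉ tsupport (deriv (deriv b)) := fun h => h4 (tsupport_deriv_subset h)
    simp only [image_eq_zero_of_notMem_tsupport h3, image_eq_zero_of_notMem_tsupport h4,
      image_eq_zero_of_notMem_tsupport h5, zero_mul, and_self]

theorem norm_sq_le_of_bound {g : Lp 𝕜 2 (volume : Measure ℝ)} {a b D : ℝ} (hab : a ≤ b)
    (h : ∀ᵐ x, (x ∈ Icc a b → ‖g x‖ ≤ D) ∧ (x ∉ Icc a b → g x = 0)) :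
    ‖g‖ ^ 2 ≤ (b - a) * D ^ 2 := by
  have h1 : ∫ x, (Icc a b).indicator (fun _ => D ^ 2) x = (b - a) * D ^ 2 := by
    rw [integral_indicator measurableSet_Icc, setIntegral_const, Real.volume_real_Icc_of_le hab,
      smul_eq_mul]
  rw [norm_sq_eq_integral, ← h1]
  apply integral_mono_ae ((memLp_two_iff_integrable_sq_norm (Lp.memLp g).1).1 (Lp.memLp g))
  · exact (integrableOn_const (by simp)).integrable_indicator measurableSet_Icc
  · filter_upwards [h] with x hx
    by_cases hm : x ∈ Icc a b
    · rw [indicator_of_mem hm]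
      have := hx.1 hm
      gcongr
    · rw [indicator_of_notMem hm, hx.2 hm]
      simp

theorem le_norm_sq_of_bound {g : Lp 𝕜 2 (volume : Measure ℝ)} {a b : ℝ} (hab : a ≤ b)
    (h : ∀ᵐ x, x ∈ Icc a b → ‖g x‖ = 1) : b - a ≤ ‖g‖ ^ 2 := by
  have h1 : ∫ x, (Icc a b).indicator (fun _ => (1 : ℝ)) x = b - a := by
    rw [integral_indicator measurableSet_Icc, setIntegral_const, Real.volume_real_Icc_of_le hab,
      smul_eq_mul, mul_one]
  rw [norm_sq_eq_integral, ← h1]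
  apply integral_mono_ae ((integrableOn_const (by simp)).integrable_indicator measurableSet_Icc)
    ((memLp_two_iff_integrable_sq_norm (Lp.memLp g).1).1 (Lp.memLp g))
  filter_upwards [h] with x hx
  by_cases hm : x ∈ Icc a b
  · rw [indicator_of_mem hm, hx hm]
    simp
  · rw [indicator_of_notMem hm]
    positivity

end Weyl

/-- Weyl sequences: plane waves with a wide plateau as amplitude, far from the origin. -/
theorem exists_weyl_sequence (k : ℝ) : ∃ D : ℝ, ∀ n : ℝ, 1 ≤ n → ∃ p ∈ newtonGraph ℂ uCusp,
    2 * n ≤ ‖p.1‖ ^ 2 ∧ ‖p.2 - ((1 + k ^ 2 : ℝ) : ℂ) • p.1‖ ^ 2 ≤ 4 * n * (D / n) ^ 2 := by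
  obtain ⟨C, hC, hplateau⟩ := exists_plateau
  refine ⟨C + 2 * |k| * C + (C + 2 * |k| * C + k ^ 2) + 4, fun n hn => ?_⟩
  have hn0 : 0 < n := by linarith
  obtain ⟨X, hX, hXu⟩ := exists_uCusp_le (δ := 1 / (2 * n)) (by positivity)
  -- The support [c - 2n, c + 2n] begins at X, beyond which u ≤ 1/(2n).
  set c := X + 2 * n with hc
  obtain ⟨Φ, Φ₁, Φ₂, hΦ, hΦ₁, hΦ₂, b0, b1, b2, hone, hzero⟩ := hplateau n c hn
  set e : ℝ → ℂ := fun x => Complex.exp (Complex.I * (k * x : ℝ)) with he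
  have hen : ∀ x, ‖e x‖ = 1 := fun x => by
    change ‖Complex.exp (Complex.I * (k * x : ℝ))‖ = 1
    rw [mul_comm]
    exact Complex.norm_exp_ofReal_mul_I _
  have hed : ∀ x, HasDerivAt e (Complex.I * k * e x) x := by
    intro x
    have h1 : HasDerivAt (fun x : ℝ => Complex.I * ((k * x : ℝ) : ℂ)) (Complex.I * k) x := by
      have := (((hasDerivAt_id x).const_mul k).ofReal_comp).const_mul Complex.I
      simpa using this
    have := h1.cexp
    refine this.congr_deriv ?_
    ring
  have hec : Continuous e := continuous_iff_continuousAt.2 fun x => (hed x).continuousAt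
  set V : ℝ → ℂ := fun x => Φ x * e x with hV
  set V₁ : ℝ → ℂ := fun x => (Φ₁ x + Complex.I * k * Φ x) * e x with hV₁
  set V₂ : ℝ → ℂ := fun x => (Φ₂ x + 2 * (Complex.I * k) * Φ₁ x - k ^ 2 * Φ x) * e x with hV₂
  have hVd : ∀ x, HasDerivAt V (V₁ x) x := by
    intro x
    refine ((hΦ x).ofReal_comp.mul (hed x)).congr_deriv ?_
    simp only [hV₁]
    ring
  have hV₁d : ∀ x, HasDerivAt V₁ (V₂ x) x := by
    intro x
    refine (((hΦ₁ x).ofReal_comp.add ((hΦ x).ofReal_comp.const_mul (Complex.I * k))).mul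
      (hed x)).congr_deriv ?_
    simp only [hV₂, Pi.add_apply]
    linear_combination (k ^ 2 * Φ x * e x : ℂ) * Complex.I_sq
  have hΦc : Continuous Φ := continuous_iff_continuousAt.2 fun x => (hΦ x).continuousAt
  have hΦ₁c : Continuous Φ₁ := continuous_iff_continuousAt.2 fun x => (hΦ₁ x).continuousAt
  have hV₂c : Continuous V₂ := by fun_prop
  have hlow : c - 2 * n = X := by rw [hc]; ring
  obtain ⟨p, hp, hp1, hp2⟩ := exists_mem_newtonGraph_of_classical hVd hV₁d hV₂c
    (α := c - 2 * n) (β := c + 2 * n) (by rw [hlow]; exact hX)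
    (fun x hx => by simp [hV, (hzero x hx).1])
    (fun x hx => by simp [hV₂, hzero x hx])
  refine ⟨p, hp, ?_, ?_⟩
  · have := le_norm_sq_of_bound (g := p.1) (a := c - n) (b := c + n) (by linarith) (by
      filter_upwards [hp1] with x hx hxm
      rw [hx, hV]
      simp only
      rw [hone x hxm, norm_mul, hen]
      simp)
    linarith
  · have := norm_sq_le_of_bound (g := p.2 - ((1 + k ^ 2 : ℝ) : ℂ) • p.1) (a := c - 2 * n)
      (b := c + 2 * n)
      (D := (C + 2 * |k| * C + (C + 2 * |k| * C + k ^ 2) + 4) / n) (by linarith) (by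
      filter_upwards [hp1, hp2, Lp.coeFn_sub p.2 (((1 + k ^ 2 : ℝ) : ℂ) • p.1),
        Lp.coeFn_smul ((1 + k ^ 2 : ℝ) : ℂ) p.1] with x h1 h2 h3 h4
      rw [h3, Pi.sub_apply, h4, Pi.smul_apply, h1, h2]
      constructor
      · intro hx
        have hxX : X ≤ x := hlow ▸ hx.1
        have hx0 : x ≠ 0 := (hX.trans_le hxX).ne'
        have hu := hXu x hxX
        have hu0 := (uCusp_mem x).1
        have hun : 1 / (2 * n) ≤ 1 / 2 := by
          apply one_div_le_one_div_of_le <;> linarith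
        have hu2 : uCusp x ^ 2 ≤ 1 / n := by
          calc uCusp x ^ 2 ≤ 1 * (1 / (2 * n)) := by
                rw [sq]
                exact mul_le_mul (uCusp_mem x).2 hu hu0.le zero_le_one
            _ ≤ 1 / n := by
                rw [one_mul]
                apply one_div_le_one_div_of_le <;> linarith
        have ha : 1 / 2 ≤ cuspWeight x := by
          unfold cuspWeight
          nlinarith
        have hapos := cuspWeight_pos hx0
        -- Three errors, each O(1/n) pointwise: derivatives of the plateau, the defect u² of the
        -- leading coefficient from 1, and the excess 2u²/a of the potential over 1.
        have hdec : -(cuspWeight x • V₂ x) + ((1 + uCusp x ^ 2) / cuspWeight x) • V x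
            - ((1 + k ^ 2 : ℝ) : ℂ) • V x
            = -((Φ₂ x + 2 * (Complex.I * k) * Φ₁ x) * e x) + ((uCusp x ^ 2 : ℝ) : ℂ) * V₂ x
              + ((2 * uCusp x ^ 2 / cuspWeight x : ℝ) : ℂ) * V x := by
          have e1 : (1 + uCusp x ^ 2) / cuspWeight x = 1 + 2 * uCusp x ^ 2 / cuspWeight x := by
            field_simp
            unfold cuspWeight
            ring
          rw [e1]
          simp only [Complex.real_smul, smul_eq_mul, cuspWeight, hV, hV₂]
          push_cast
          ring
        have n1 : ‖(Φ₂ x + 2 * (Complex.I * k) * Φ₁ x : ℂ)‖ ≤ (C + 2 * |k| * C) / n := by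
          refine (norm_add_le _ _).trans ?_
          simp only [norm_mul, Complex.norm_real, Complex.norm_I, Real.norm_eq_abs, one_mul,
            Complex.norm_ofNat]
          calc |Φ₂ x| + 2 * |k| * |Φ₁ x| ≤ C / n + 2 * |k| * (C / n) := by
                gcongr
                · exact b2 x
                · exact b1 x
            _ = _ := by ring
        have n2 : ‖V₂ x‖ ≤ C + 2 * |k| * C + k ^ 2 := by
          rw [hV₂]
          simp only
          rw [norm_mul, hen, mul_one]
          refine (norm_sub_le _ _).trans (add_le_add (n1.trans ?_) ?_)
          · exact div_le_self (by positivity) hn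
          · simp only [norm_mul, norm_pow, Complex.norm_real, Real.norm_eq_abs, sq_abs]
            exact mul_le_of_le_one_right (sq_nonneg k) (b0 x)
        have n3 : ‖V x‖ ≤ 1 := by
          rw [hV]
          simp only
          rw [norm_mul, hen, mul_one, Complex.norm_real]
          exact b0 x
        have n4 : 2 * uCusp x ^ 2 / cuspWeight x ≤ 4 / n := by
          rw [div_le_iff₀ hapos]
          calc 2 * uCusp x ^ 2 ≤ 2 * (1 / n) := by gcongr
            _ = 4 / n * (1 / 2) := by ring
            _ ≤ 4 / n * cuspWeight x := by gcongr
        rw [hdec]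
        calc _ ≤ ‖-((Φ₂ x + 2 * (Complex.I * k) * Φ₁ x) * e x)‖
              + ‖((uCusp x ^ 2 : ℝ) : ℂ) * V₂ x‖
              + ‖((2 * uCusp x ^ 2 / cuspWeight x : ℝ) : ℂ) * V x‖ := norm_add₃_le
          _ ≤ (C + 2 * |k| * C) / n + 1 / n * (C + 2 * |k| * C + k ^ 2) + 4 / n * 1 := by
              refine add_le_add (add_le_add ?_ ?_) ?_
              · rwa [norm_neg, norm_mul, hen, mul_one]
              · rw [norm_mul, Complex.norm_real, Real.norm_of_nonneg (by positivity)]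
                gcongr
              · rw [norm_mul, Complex.norm_real, Real.norm_of_nonneg (by positivity)]
                gcongr
          _ = _ := by ring
      · intro hx
        simp [hV, hV₂, hzero x hx])
    refine this.trans (le_of_eq ?_)
    ring

/-- Along the Weyl sequence ‖v‖² grows like n while ‖(L - 1 - k²)v‖² is O(1/n), so no bounded left
inverse exists. -/
theorem not_isBoundedInverse_shiftOp (k : ℝ)
    (R : Lp ℂ 2 (volume : Measure ℝ) →L[ℂ] Lp ℂ 2 (volume : Measure ℝ)) :
    ¬ IsBoundedInverse (shiftOp (newtonOp ℂ uCusp) ((1 + k ^ 2 : ℝ) : ℂ)) R := by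
  rintro ⟨-, hR⟩
  obtain ⟨D, hD⟩ := exists_weyl_sequence k
  -- Boundedness would give n² ≤ 2‖R‖²D² = n - 1, impossible for n ≥ 1.
  set n := ‖R‖ ^ 2 * D ^ 2 * 2 + 1 with hn
  have hn1 : 1 ≤ n := by
    have : 0 ≤ ‖R‖ ^ 2 * D ^ 2 * 2 := by positivity
    linarith
  obtain ⟨⟨v, f⟩, hp, h1, h2⟩ := hD n hn1
  simp only at h1 h2
  obtain ⟨hv, hvf⟩ := mem_newtonOp_graph.1 hp
  have h3 : R (newtonOp ℂ uCusp ⟨v, hv⟩ - ((1 + k ^ 2 : ℝ) : ℂ) • v) = v := hR ⟨v, hv⟩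
  rw [hvf] at h3
  have h4 := R.le_opNorm (f - ((1 + k ^ 2 : ℝ) : ℂ) • v)
  rw [h3] at h4
  have h5 : ‖v‖ ^ 2 ≤ ‖R‖ ^ 2 * (4 * n * (D / n) ^ 2) := by
    calc ‖v‖ ^ 2 ≤ (‖R‖ * ‖f - ((1 + k ^ 2 : ℝ) : ℂ) • v‖) ^ 2 := by gcongr
      _ = ‖R‖ ^ 2 * ‖f - ((1 + k ^ 2 : ℝ) : ℂ) • v‖ ^ 2 := mul_pow _ _ _
      _ ≤ _ := by gcongr
  have h6 : 2 * n * n ≤ ‖R‖ ^ 2 * D ^ 2 * 4 := by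
    have h7 : 2 * n ≤ ‖R‖ ^ 2 * D ^ 2 * 4 / n := by
      refine (h1.trans h5).trans (le_of_eq ?_)
      field_simp
    rwa [le_div_iff₀ (by linarith)] at h7
  nlinarith

theorem opSpectrum_newtonOp :
    opSpectrum (newtonOp ℂ uCusp) = {z : ℂ | z.im = 0 ∧ 1 ≤ z.re} := by
  ext z
  rw [opSpectrum, mem_compl_iff, mem_ofPred_eq, mem_ofPred_eq]
  constructor
  · intro h
    by_contra hz
    refine h (exists_isBoundedInverse_shiftOp ?_)
    -- Positivity of this quantity says that 1 - z lies off (-∞, 0]: either its real part is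
    -- positive, or its imaginary part makes |Re| < ‖·‖.
    change 0 < ‖1 - z‖ + (1 - z).re
    by_cases him : z.im = 0
    · have hre : z.re < 1 := not_le.1 fun h' => hz ⟨him, h'⟩
      have : 0 < (1 - z).re := by
        rw [Complex.sub_re, Complex.one_re]
        linarith
      positivity
    · have h1 : |(1 - z).re| < ‖1 - z‖ := Complex.abs_re_lt_norm.2 (by simpa using him)
      linarith [neg_abs_le (1 - z).re]
  · rintro ⟨him, hre⟩ ⟨R, hR⟩
    refine not_isBoundedInverse_shiftOp (Real.sqrt (z.re - 1)) R ?_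
    rw [Real.sq_sqrt (by linarith), add_sub_cancel]
    convert hR
    apply Complex.ext <;> simp [him]

/-! ### Well-posedness of the Newton step. -/

theorem IsNewtonResidual.unique {g r r' : Lp ℝ 2 (volume : Measure ℝ)}
    (h : IsNewtonResidual g r) (h' : IsNewtonResidual g r') : r = r' := by
  obtain ⟨w, hw, hr⟩ := h
  obtain ⟨w', hw', hr'⟩ := h'
  -- Two weak second derivatives of g differ by one of the zero function, which vanishes almost
  -- everywhere.
  have h1 := hw.add (hw'.smul (-1))
  rw [neg_one_smul, add_neg_cancel] at h1
  apply Lp.ext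
  filter_upwards [hr, hr', h1.ae_eq_zero] with x h2 h3 h4
  rw [Pi.add_apply, Pi.smul_apply, Pi.zero_apply, smul_eq_mul, neg_one_mul,
    add_neg_eq_zero] at h4
  rw [h2, h3, h4]

theorem existsUnique_isNewtonStep {g r : Lp ℝ 2 (volume : Measure ℝ)}
    (hr : IsNewtonResidual g r) : ∃! h, IsNewtonStep uCusp g h := by
  obtain ⟨R, hR, hR'⟩ := exists_isBoundedInverse_newtonOp ℝ
  refine ⟨g - R r, ⟨r, hr, ?_⟩, ?_⟩
  · rw [sub_sub_cancel]
    exact hR r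
  · rintro h ⟨r', hr', hd, hL⟩
    -- The left inverse determines g - h from the residual, and the residual is determined by g.
    have := hR' ⟨g - h, hd⟩
    rw [hL, hr'.unique hr] at this
    simp only at this
    rw [this, sub_sub_cancel]

theorem proposition4p4 :
    opSpectrum (newtonOp ℂ uCusp) = {z : ℂ | z.im = 0 ∧ 1 ≤ z.re} ∧
    (∃ R : Lp ℂ 2 (volume : Measure ℝ) →L[ℂ] Lp ℂ 2 (volume : Measure ℝ),
      IsBoundedInverse (newtonOp ℂ uCusp) R) ∧
    (∃ R : Lp ℝ 2 (volume : Measure ℝ) →L[ℝ] Lp ℝ 2 (volume : Measure ℝ),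
      IsBoundedInverse (newtonOp ℝ uCusp) R) ∧
    (∀ g : Lp ℝ 2 (volume : Measure ℝ), (∃ r, IsNewtonResidual g r) →
      ∃! h, IsNewtonStep uCusp g h) :=
  ⟨opSpectrum_newtonOp, exists_isBoundedInverse_newtonOp ℂ, exists_isBoundedInverse_newtonOp ℝ,
    fun _ ⟨_, hr⟩ => existsUnique_isNewtonStep hr⟩
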